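/- **Setting.** Let $\mathcal U$ be an ultrafilter on a set $\iota$, and for a set $X$ let ${}^{*}X=X^{\iota}/\mathcal U$ be its nonstandard extension (ultrapower); internal sets and functions are those represented by families $(A_i)_{i\in\iota}$, $(f_i)_{i\in\iota}$ of standard sets and functions. Hyperfinite sums, integrals, powers and other standard operations are extended to internal objects by applying them to representatives. A *hyper number field* is an internal subfield ${}^{*}K\subset{}^{*}\mathbb C$ of hyperfinite degree $n\in{}^{*}\mathbb N$ over ${}^{*}\mathbb Q$, i.e. one represented by number fields $K_i\subset\mathbb C$. Let $d$ be its discriminant, $r\in{}^{*}\mathbb N$ its number of infinite places, ${}^{*}R$ its regulator, $w\in{}^{*}\mathbb N$ its number of roots of unity, ${}^{*}\mathcal D$ its different over ${}^{*}\mathbb Q$, and $Cl$ the internal ideal class group of its ring of hyperintegers. For $\mathcal I\in Cl$ and $s\in{}^{*}\mathbb C$ with ${}^{*}\mathrm{Re}(s)>1$ put $$\zeta_{{}^{*}K}(\mathcal I,s)=\sum_{\mathfrak a\in\mathcal I}\frac1{N(\mathfrak a)^{s}},$$ the sum being over the nonzero internal integral ideals $\mathfrak a$ in the class $\mathcal I$,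 understood as the Q-limit, as $M\to\infty$ in ${}^{*}\mathbb N$, of the hyperfinite sums over those $\mathfrak a$ with $N(\mathfrak a)\le M$. Let $${}^{*}Z(\mathcal I,s)=|d|^{s/2}\,\pi^{-ns/2}\,\Gamma_{{}^{*}K}(s/2)\,\zeta_{{}^{*}K}(\mathcal I,s).$$ Here $\Gamma_{{}^{*}K}(s)=\int \prod_{\tau}e^{-y_\tau}y_\tau^{s}\,\frac{dy}{y}$ is the internal integral over the group of positive vectors $y=(y_\tau)$, indexed by the $n$ embeddings $\tau$ of ${}^{*}K$ in ${}^{*}\mathbb C$, with $y_{\bar\tau}=y_\tau$; the measure $dy/y$ is the product, over the infinite places, of the measures $dt/t$ in the coordinates $t=y_\tau$ at real places and $t=y_\tau^2$ at complex places. The prefix Q refers to limits and derivatives defined with $\varepsilon,\delta$ ranging over all positive elements of ${}^{*}\mathbb R$ (and indices over ${}^{*}\mathbb N$). A function is *Q-analytic* in a set if it is internal and infinitely Q-differentiable at all points of that set. **Theorem.** The sums defining $\zeta_{{}^{*}K}(\mathcal I,s)$ Q-converge for ${}^{*}\mathrm{Re}(s)>1$. For every $\mathcal I\in Cl$ the function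 ${}^{*}Z(\mathcal I,s)$ admits a Q-analytic continuation to ${}^{*}\mathbb C\setminus\{0,1\}$. These continuations satisfy $${}^{*}Z(\mathcal I,s)={}^{*}Z(\mathcal I',1-s)\qquad(s\in{}^{*}\mathbb C\setminus\{0,1\})$$ whenever $\mathcal I\mathcal I'=[{}^{*}\mathcal D]$, the ideal class of the different. Moreover ${}^{*}Z(\mathcal I,s)$ has simple poles at $s=0$ and $s=1$, with residues $-2^{r}\,{}^{*}R/w$ and $2^{r}\,{}^{*}R/w$ respectively. -/

import Mathlib

open Filter MeasureTheory NumberField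
open scoped nonZeroDivisors

noncomputable section

namespace HyperZeta

/-! ### The nonstandard extension as an ultrapower -/

/-- The nonstandard extension `*α` of `α`: the ultrapower of `α` along the ultrafilter `U`. -/
abbrev Hyper {ι : Type*} (U : Ultrafilter ι) (α : Type*) : Type _ := Germ (U : Filter ι) α

/-- The internal function `*α → *β` represented by a family of functions `g i : α → β`,
`[x i] ↦ [g i (x i)]`. -/
def internalMap {ι : Type*} (U : Ultrafilter ι) {α β : Type*} (g : ι → α → β) :
    Hyper U α → Hyper U β :=
  Germ.map₂ (fun f a => f a) (Germ.ofFun g)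

/-- A function `*α → *β` is internal if it is represented by a family of functions. -/
def IsInternal {ι : Type*} {U : Ultrafilter ι} {α β : Type*}
    (f : Hyper U α → Hyper U β) : Prop :=
  ∃ g : ι → α → β, f = internalMap U g

/-- The internal function of two variables represented by a family of functions,
`([x i], [y i]) ↦ [g i (x i) (y i)]`. -/
def internalMap₂ {ι : Type*} (U : Ultrafilter ι) {α β γ : Type*} (g : ι → α → β → γ) :
    Hyper U α → Hyper U β → Hyper U γ :=
  fun x => Germ.map₂ (fun f b => f b) (internalMap U g x)

/-- A function of two variables is internal if it is represented by a family of functions. -/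
def IsInternal₂ {ι : Type*} {U : Ultrafilter ι} {α β γ : Type*}
    (f : Hyper U α → Hyper U β → Hyper U γ) : Prop :=
  ∃ g : ι → α → β → γ, f = internalMap₂ U g

/-- The hyperreal modulus `|z|` of a hypercomplex number. -/
def hyperAbs {ι : Type*} {U : Ultrafilter ι} (z : Hyper U ℂ) : Hyper U ℝ :=
  Germ.map (fun w : ℂ => ‖w‖) z

/-- The hyperreal part of a hypercomplex number. -/
def hyperRe {ι : Type*} {U : Ultrafilter ι} (z : Hyper U ℂ) : Hyper U ℝ :=
  Germ.map Complex.re z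

/-! ### Analysis in the Q-topology -/

/-- The hypersequence `x` Q-converges to `L`: the usual definition, with `ε` ranging over all
positive hyperreals and indices ranging over the hypernaturals. -/
def QTendsto {ι : Type*} {U : Ultrafilter ι} (x : Hyper U ℕ → Hyper U ℂ) (L : Hyper U ℂ) : Prop :=
  ∀ ε : Hyper U ℝ, 0 < ε → ∃ N : Hyper U ℕ, ∀ n : Hyper U ℕ, N ≤ n → hyperAbs (x n - L) < ε

/-- `f'` is the Q-derivative of `f` at `z₀`. -/
def HasQDerivAt {ι : Type*} {U : Ultrafilter ι} (f : Hyper U ℂ → Hyper U ℂ)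
    (f' z₀ : Hyper U ℂ) : Prop :=
  ∀ ε : Hyper U ℝ, 0 < ε → ∃ δ : Hyper U ℝ, 0 < δ ∧ ∀ h : Hyper U ℂ, h ≠ 0 → hyperAbs h < δ →
    hyperAbs ((f (z₀ + h) - f z₀) / h - f') < ε

/-- `f` is Q-analytic in `B`: it is internal and infinitely Q-differentiable at all points of `B`.
Here `F n` is the `n`-th Q-derivative, for all `n ∈ *ℕ` (in particular for all `n ∈ ℕ`). -/
def QAnalyticOn {ι : Type*} {U : Ultrafilter ι} (f : Hyper U ℂ → Hyper U ℂ)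
    (B : Set (Hyper U ℂ)) : Prop :=
  IsInternal f ∧ ∃ F : Hyper U ℕ → Hyper U ℂ → Hyper U ℂ, IsInternal₂ F ∧ F 0 = f ∧
    ∀ n : Hyper U ℕ, ∀ z ∈ B, HasQDerivAt (F n) (F (n + 1) z) z

/-- `f` has a simple pole at `a` with residue `ρ ≠ 0`: on a punctured Q-ball around `a` it is
`g z / (z - a)` with `g` Q-analytic in the Q-ball and `g a = ρ`. -/
def HasSimpleQPole {ι : Type*} {U : Ultrafilter ι} (f : Hyper U ℂ → Hyper U ℂ)
    (a ρ : Hyper U ℂ) : Prop :=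
  ρ ≠ 0 ∧ ∃ r : Hyper U ℝ, 0 < r ∧ ∃ g : Hyper U ℂ → Hyper U ℂ,
    QAnalyticOn g {z | hyperAbs (z - a) < r} ∧ g a = ρ ∧
    ∀ z : Hyper U ℂ, z ≠ a → hyperAbs (z - a) < r → f z = g z / (z - a)

/-! ### Number fields: the standard objects whose nonstandard extensions are taken -/

section Standard

/-- The Haar measure `dt/t` on the multiplicative group of positive reals. -/
def mulHaar : Measure ℝ :=
  (volume.restrict (Set.Ioi 0)).withDensity fun t => ENNReal.ofReal t⁻¹

/-- The isomorphism from `∏_v ℝ_{>0}` (`v` the infinite places) to the group of positive vectors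
`(y_τ)` indexed by the complex embeddings `τ` of `F` with `y_{τ̄} = y_τ`. It is the inverse of the
map whose `v`-coordinate is `y_τ` if `v` is real and `y_τ ^ 2` if `v` is complex (`τ` any embedding
in `v`). -/
def posVector {F : Type*} [Field F] [NumberField F] (t : InfinitePlace F → ℝ) (τ : F →+* ℂ) : ℝ :=
  open Classical in
  if (InfinitePlace.mk τ).IsReal then t (InfinitePlace.mk τ) else √(t (InfinitePlace.mk τ))

/-- The gamma function of a number field, for a vector `s = (s_τ)` indexed by the complex
embeddings: the integral of the norm `𝒩(exp(-y) y ^ s) = ∏_τ exp(-y_τ) y_τ ^ (s_τ)` over the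
positive vectors `y`, for the measure `dy/y` that is the product of the measures `dt/t`. -/
def higherGamma (F : Type*) [Field F] [NumberField F] (s : (F →+* ℂ) → ℂ) : ℂ :=
  ∫ t : InfinitePlace F → ℝ,
    ∏ τ : F →+* ℂ, ((Real.exp (-posVector t τ) : ℝ) : ℂ) * ((posVector t τ : ℝ) : ℂ) ^ s τ
    ∂(Measure.pi fun _ => mulHaar)

/-- The Euler factor at infinity `|d_F|^{s/2} π^{-ns/2} Γ_F(s/2)`, where `n = [F : ℚ]`. -/
def eulerFactorInfty (F : Type*) [Field F] [NumberField F] (s : ℂ) : ℂ :=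
  ((|discr F| : ℤ) : ℂ) ^ (s / 2) * (Real.pi : ℂ) ^ (-(Module.finrank ℚ F : ℂ) * s / 2) *
    higherGamma F fun _ => s / 2

/-- There are finitely many nonzero integral ideals of norm at most `M` in an ideal class. -/
theorem finite_ideals (F : Type*) [Field F] [NumberField F] (c : ClassGroup (𝓞 F)) (M : ℕ) :
    {a : (Ideal (𝓞 F))⁰ | ClassGroup.mk0 a = c ∧ Ideal.absNorm (a : Ideal (𝓞 F)) ≤ M}.Finite :=
  ((Ideal.finite_setOfPred_absNorm_le M).preimage Subtype.val_injective.injOn).subset fun _ ha => ha.2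

/-- The finite sum of `1 / N(a)^s` over the nonzero integral ideals `a` in the class `c`
with `N(a) ≤ M`. -/
def zetaPartialSum (F : Type*) [Field F] [NumberField F] (c : ClassGroup (𝓞 F)) (M : ℕ) (s : ℂ) :
    ℂ :=
  ∑ a ∈ (finite_ideals F c M).toFinset, 1 / ((Ideal.absNorm (a : Ideal (𝓞 F)) : ℕ) : ℂ) ^ s

/-- The class of the different of `F / ℚ` in the ideal class group. -/
def differentClass (F : Type*) [Field F] [NumberField F] : ClassGroup (𝓞 F) :=
  ClassGroup.mk0 ⟨differentIdeal ℤ (𝓞 F), mem_nonZeroDivisors_of_ne_zero differentIdeal_ne_bot⟩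

/-- The number `2^r R / w`, where `r` is the number of infinite places of `F`, `R` its regulator
and `w` its number of roots of unity. -/
def residueConst (F : Type*) [Field F] [NumberField F] : ℂ :=
  2 ^ Fintype.card (InfinitePlace F) * (Units.regulator F : ℂ) / (Units.torsionOrder F : ℂ)

end Standard

/-! ### Hyper number fields -/

/-- A hyper (algebraic) number field: an internal subfield of `*ℂ` whose (internal) dimension
over `*ℚ` is hyperfinite. As an internal set it is represented by a family of subfields of `ℂ`,
and hyperfiniteness of the degree means that these have finite degree over `ℚ`. -/
structure HyperNumberField {ι : Type*} (U : Ultrafilter ι) where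
  /-- the subfield of `*ℂ` -/
  toSubfield : Subfield (Hyper U ℂ)
  /-- the subfields of `ℂ` that represent it -/
  rep : ι → Subfield ℂ
  numberField : ∀ i, NumberField (rep i)
  mem_iff : ∀ x : ι → ℂ, (Germ.ofFun x : Hyper U ℂ) ∈ toSubfield ↔ ∀ᶠ i in U, x i ∈ rep i

attribute [instance] HyperNumberField.numberField

namespace HyperNumberField

/-- The internal ideal class group of the ring of hyperintegers of `K`: the internal classes
of nonzero internal fractional ideals, that is, the ultraproduct of the ideal class groups. -/
def Cl {ι : Type*} {U : Ultrafilter ι} (K : HyperNumberField U) : Type _ :=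
  Filter.Product (U : Filter ι) fun i => ClassGroup (𝓞 (K.rep i))

/-- The internal ideal class represented by a family of ideal classes. -/
def Cl.ofFun {ι : Type*} {U : Ultrafilter ι} (K : HyperNumberField U)
    (c : ∀ i, ClassGroup (𝓞 (K.rep i))) : K.Cl :=
  Quotient.mk (productSetoid (U : Filter ι) fun i => ClassGroup (𝓞 (K.rep i))) c

/-- Multiplication of internal ideal classes. -/
instance {ι : Type*} {U : Ultrafilter ι} (K : HyperNumberField U) : Mul K.Cl where
  mul := Quotient.map₂ (fun c d i => c i * d i) fun _ _ hc _ _ hd => by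
    filter_upwards [hc, hd] with i h₁ h₂
    rw [h₁, h₂]

/-- The class of the different of `K / *ℚ`. -/
def differentClass {ι : Type*} {U : Ultrafilter ι} (K : HyperNumberField U) : K.Cl :=
  Cl.ofFun K fun i => HyperZeta.differentClass (K.rep i)

/-- The hyperfinite sum of `1 / N(a)^s` over the nonzero internal integral ideals `a` in the
internal class `I` with `N(a) ≤ M`, where `M ∈ *ℕ` and `s ∈ *ℂ`. -/
def zetaPartialSum {ι : Type*} {U : Ultrafilter ι} (K : HyperNumberField U) (I : K.Cl) :
    Hyper U ℕ → Hyper U ℂ → Hyper U ℂ :=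
  Quotient.liftOn I (fun c => internalMap₂ U fun i => HyperZeta.zetaPartialSum (K.rep i) (c i)) <| by
    intro c d h
    funext M s
    induction M using Germ.inductionOn with | _ M => ?_
    induction s using Germ.inductionOn with | _ s => ?_
    refine Germ.coe_eq.2 ?_
    filter_upwards [h] with i hi
    rw [hi]

/-- The partial zeta function of `I` at `s`, the sum of `1 / N(a)^s` over all nonzero internal
integral ideals `a` in `I`, exists and is equal to `σ`. -/
def HasPartialZeta {ι : Type*} {U : Ultrafilter ι} (K : HyperNumberField U) (I : K.Cl)
    (s σ : Hyper U ℂ) : Prop :=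
  QTendsto (fun M => K.zetaPartialSum I M s) σ

/-- The Euler factor at infinity `*Z_∞(s) = |d_K|^{s/2} π^{-ns/2} Γ_K(s/2)` of `K`. -/
def eulerFactorInfty {ι : Type*} {U : Ultrafilter ι} (K : HyperNumberField U) :
    Hyper U ℂ → Hyper U ℂ :=
  internalMap U fun i => HyperZeta.eulerFactorInfty (K.rep i)

/-- The hyperreal number `2^r R / w` of `K`, as a hypercomplex number. -/
def residueConst {ι : Type*} {U : Ultrafilter ι} (K : HyperNumberField U) : Hyper U ℂ :=
  Germ.ofFun fun i => HyperZeta.residueConst (K.rep i)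

/-- `Z` is a Q-analytic continuation to `*ℂ ∖ {0, 1}` of the completed partial zeta function
`*Z(I, s) = *Z_∞(s) ζ_K(I, s)`, which is defined for `Re s > 1`. -/
def IsCompletedZetaContinuation {ι : Type*} {U : Ultrafilter ι} (K : HyperNumberField U)
    (I : K.Cl) (Z : Hyper U ℂ → Hyper U ℂ) : Prop :=
  QAnalyticOn Z {0, 1}ᶜ ∧
    ∀ s : Hyper U ℂ, 1 < hyperRe s → ∃ σ, K.HasPartialZeta I s σ ∧ Z s = K.eulerFactorInfty s * σ

end HyperNumberField

end HyperZeta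

end

/-! At each index this is Hecke's classical theorem on the partial zeta function of an ideal class;
the hyper statement is assembled from these index by index.

For a class c choose a fractional ideal J in c⁻¹. Nonzero x ∈ J, taken up to units, correspond to
integral ideals a ∈ c through (x) = aJ. Consider θ_J(y) = ∑_{x ∈ J} exp(-π ∑_τ y_τ |τx|²).
Integrating θ_J - 1 over a fundamental domain for the units, at fixed norm of y, and unfolding
(`hasSum_gammaRadial`) yields a sum over a ∈ c of w·G(π^n N(a)² T/|d|), where G = `gammaRadial`
integrates exp(-∑ y_τ) over the positive vectors of given norm. The Mellin transform of G is the
gamma function of the field (`mellin_gammaRadial`), so that of the mean of θ_J - 1, taken at s/2, is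
w times the completed zeta function for Re s > 1 (`hasSum_thetaPair_Λ`).

The symmetry comes from Poisson summation. The Gram matrix of J at weights y has as inverse the Gram
matrix of the trace-dual basis at weights y⁻¹ (`embGram_inv`), whence `idealTheta_inversion`. Once
the norm is normalised by the discriminant of J, the means satisfy M_J(1/T) = T^{1/2} M_{J'}(T) with
J' = (𝔇J)⁻¹ (`thetaMean_one_div`). The class of J' is c'⁻¹ exactly when cc' = [𝔇], and the mean
depends only on the class of the ideal.

The mean tends to 2^{r-1}R faster than any power of T, so `WeakFEPair` supplies the continuation,
the functional equation and the polar parts. Dividing 2^{r-1}R by w, and doubling it because the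
variable is s/2, gives 2^r R/w.

For the transfer, a δ or N is chosen at every index; its germ then serves all germs of increments or
indices at once (`hasQDerivAt_internalMap`, `qTendsto_of_tendsto`). Q-derivatives of hypernatural
order are germs of ordinary iterated derivatives, which exist because the functions are holomorphic.
-/

noncomputable section

namespace HyperZeta

/-! ### Poisson summation for ℤᵈ in ℝᵈ -/

section Poisson

open UnitAddTorus

variable {d : Type*} [Fintype d]

/-- The quotient map from `ℝᵈ` to the torus. -/
def torusMk (x : d → ℝ) : UnitAddTorus d := fun i => (x i : UnitAddCircle)

/-- An integral vector, as a real vector. -/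
abbrev intVec (m : d → ℤ) : d → ℝ := fun i => (m i : ℝ)

omit [Fintype d] in
lemma isQuotientMap_torusMk : Topology.IsQuotientMap (torusMk : (d → ℝ) → UnitAddTorus d) :=
  (IsOpenQuotientMap.piMap (f := fun (_ : d) (x : ℝ) => (x : UnitAddCircle)) fun _ =>
    QuotientAddGroup.isOpenQuotientMap_mk).isQuotientMap

omit [Fintype d] in
lemma torusMk_eq_iff {x y : d → ℝ} :
    torusMk x = torusMk y ↔ ∃ m : d → ℤ, y = x + intVec m := by
  constructor
  · intro h
    have h' : ∀ i, ∃ m : ℤ, y i = x i + m := by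
      intro i
      have hi : ((x i : ℝ) : UnitAddCircle) = y i := congrFun h i
      obtain ⟨m, hm⟩ := (AddSubgroup.mem_zmultiples_iff).1 ((QuotientAddGroup.eq).1 hi)
      refine ⟨m, ?_⟩
      simp only [zsmul_eq_mul, mul_one] at hm
      linarith
    choose m hm using h'
    exact ⟨m, funext hm⟩
  · rintro ⟨m, rfl⟩
    funext i
    refine (QuotientAddGroup.eq).2 ((AddSubgroup.mem_zmultiples_iff).2 ⟨m i, ?_⟩)
    simp

lemma mFourier_torusMk (n : d → ℤ) (x : d → ℝ) :
    mFourier n (torusMk x) = Complex.exp (2 * Real.pi * Complex.I * ∑ i, (n i : ℂ) * x i) := by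
  simp only [mFourier, ContinuousMap.coe_mk, torusMk, fourier_coe_apply, Finset.mul_sum,
    Complex.exp_sum]
  refine Finset.prod_congr rfl fun i _ => ?_
  congr 1
  push_cast
  ring

/-- The half-open unit cubes with integral corners tile `ℝᵈ`. -/
lemma integral_eq_tsum_cube (f : (d → ℝ) → ℂ) (hf : Integrable f) :
    ∫ x, f x = ∑' m : d → ℤ,
      ∫ x in {x : d → ℝ | ∀ i, x i ∈ Set.Ioc (0 : ℝ) (0 + 1)}, f (x + intVec m) := by
  set S : Set (d → ℝ) := {x : d → ℝ | ∀ i, x i ∈ Set.Ioc (0 : ℝ) (0 + 1)} with hS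
  have hSm : MeasurableSet S := MeasurableSet.univ_pi' fun i => measurableSet_Ioc
  set C : (d → ℤ) → Set (d → ℝ) := fun m => (fun x => x + intVec m) '' S with hC
  have hCm : ∀ m, MeasurableSet (C m) := fun m =>
    (MeasurableEquiv.addRight (intVec m)).measurableEmbedding.measurableSet_image' hSm
  have hmem : ∀ m x, x ∈ C m ↔ ∀ i, (m i : ℝ) < x i ∧ x i ≤ m i + 1 := by
    intro m x
    constructor
    · rintro ⟨y, hy, rfl⟩ i
      have := hy i
      simp only [Set.mem_Ioc, Pi.add_apply] at this ⊢
      constructor <;> linarith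
    · intro h
      refine ⟨x - intVec m, fun i => ?_, by simp⟩
      have := h i
      simp only [Set.mem_Ioc, Pi.sub_apply]
      constructor <;> linarith
  have hdisj : Pairwise (Function.onFun Disjoint C) := by
    intro m m' hmm
    refine Set.disjoint_left.2 fun x hx hx' => hmm (funext fun i => ?_)
    have h1 := (hmem _ _).1 hx i
    have h2 := (hmem _ _).1 hx' i
    have h3 : (m i : ℝ) < m' i + 1 := by linarith
    have h4 : (m' i : ℝ) < m i + 1 := by linarith
    norm_cast at h3 h4
    omega
  have huniv : ⋃ m, C m = Set.univ := by
    -- The cubes are open on the left and closed on the right, so the corner is the ceiling minus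
    -- one and not the floor.
    refine Set.eq_univ_of_forall fun x => Set.mem_iUnion.2 ⟨fun i => ⌈x i⌉ - 1, ?_⟩
    rw [hmem]
    intro i
    have := Int.ceil_lt_add_one (x i)
    have := Int.le_ceil (x i)
    push_cast
    constructor <;> linarith
  rw [← setIntegral_univ, ← huniv, integral_iUnion hCm hdisj hf.integrableOn]
  refine tsum_congr fun m => ?_
  exact (measurePreserving_add_right volume (intVec m)).setIntegral_image_emb
    (MeasurableEquiv.addRight (intVec m)).measurableEmbedding f S

/-- **Poisson summation** on `ℝᵈ`. -/
theorem tsum_eq_tsum_fourier (f : (d → ℝ) → ℂ) (hc : Continuous f) (hf : Integrable f)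
    (hb : ∀ R : ℝ, ∃ u : (d → ℤ) → ℝ, Summable u ∧ ∀ x : d → ℝ, ‖x‖ ≤ R →
      ∀ m, ‖f (x + intVec m)‖ ≤ u m)
    (hs : Summable fun m : d → ℤ =>
      ∫ x, Complex.exp (-(2 * Real.pi * Complex.I * ∑ i, (m i : ℂ) * x i)) * f x) :
    ∑' m : d → ℤ, f (intVec m) = ∑' m : d → ℤ,
      ∫ x, Complex.exp (-(2 * Real.pi * Complex.I * ∑ i, (m i : ℂ) * x i)) * f x := by
  set g : (d → ℝ) → ℂ := fun x => ∑' m : d → ℤ, f (x + intVec m) with hg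
  have hgc : Continuous g := by
    rw [continuous_iff_continuousAt]
    intro x
    obtain ⟨u, hu, hfu⟩ := hb (‖x‖ + 1)
    have : ContinuousOn g (Metric.ball x 1) := by
      refine continuousOn_tsum (fun m => (hc.comp (continuous_id.add continuous_const)).continuousOn)
        hu fun m y hy => hfu y ?_ m
      rw [Metric.mem_ball, dist_eq_norm] at hy
      have := norm_le_norm_add_norm_sub' y x
      linarith
    exact this.continuousAt (Metric.ball_mem_nhds x one_pos)
  have hper : ∀ x y, torusMk x = torusMk y → g x = g y := by
    intro x y h
    obtain ⟨m, rfl⟩ := torusMk_eq_iff.1 h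
    refine ((Equiv.addLeft m).tsum_eq fun k => f (x + intVec k)).symm.trans (tsum_congr fun k => ?_)
    congr 1
    funext i
    simp [intVec, add_assoc]
  let π : C(d → ℝ, UnitAddTorus d) := ⟨torusMk, isQuotientMap_torusMk.continuous⟩
  have hπ : Topology.IsQuotientMap π := isQuotientMap_torusMk
  let G : C(UnitAddTorus d, ℂ) := hπ.lift ⟨g, hgc⟩ fun x y h => hper x y h
  have hG : ∀ x, G (torusMk x) = g x := fun x =>
    ContinuousMap.congr_fun (hπ.lift_comp ⟨g, hgc⟩ fun x y h => hper x y h) x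
  -- The characters are periodic, so integrating the periodised function over one cube amounts to
  -- integrating `f` over all of space.
  have hcoef : ∀ n : d → ℤ, mFourierCoeff G n =
      ∫ x, Complex.exp (-(2 * Real.pi * Complex.I * ∑ i, (n i : ℂ) * x i)) * f x := by
    intro n
    set e : (d → ℝ) → ℂ :=
      fun x => Complex.exp (-(2 * Real.pi * Complex.I * ∑ i, (n i : ℂ) * x i)) with he
    have hec : Continuous e := by fun_prop
    have hen : ∀ x, ‖e x‖ = 1 := by
      intro x
      have : -(2 * Real.pi * Complex.I * ∑ i, (n i : ℂ) * x i) =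
          ((-(2 * Real.pi * ∑ i, (n i : ℝ) * x i) : ℝ) : ℂ) * Complex.I := by
        push_cast; ring
      simp only [he, this, Complex.norm_exp_ofReal_mul_I]
    have hem : ∀ x, mFourier (-n) (torusMk x) = e x := by
      intro x
      rw [mFourier_torusMk]
      simp [he, Finset.sum_neg_distrib]
    have hep : ∀ x m, e (x + intVec m) = e x := by
      intro x m
      rw [← hem, ← hem, (torusMk_eq_iff.2 ⟨m, rfl⟩ : torusMk x = torusMk (x + intVec m))]
    have hint : Integrable fun x => e x * f x :=
      hf.bdd_mul hec.aestronglyMeasurable (Eventually.of_forall fun x => (hen x).le)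
    rw [mFourierCoeff_eq_integral _ _ (fun _ => 0), integral_eq_tsum_cube _ hint]
    simp only [hep]
    set S : Set (d → ℝ) := {x : d → ℝ | ∀ i, x i ∈ Set.Ioc (0 : ℝ) (0 + 1)} with hS
    have hSm : MeasurableSet S := MeasurableSet.univ_pi' fun i => measurableSet_Ioc
    have hSb : ∀ x ∈ S, ‖x‖ ≤ 1 := by
      intro x hx
      refine (pi_norm_le_iff_of_nonneg zero_le_one).2 fun i => ?_
      have := hx i
      simp only [zero_add, Set.mem_Ioc] at this
      rw [Real.norm_eq_abs, abs_le]
      constructor <;> linarith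
    have hSf : volume S < ⊤ := 
      (isBounded_iff_forall_norm_le.2 ⟨1, hSb⟩ : Bornology.IsBounded S).measure_lt_top
    obtain ⟨u, hu, hfu⟩ := hb 1
    have key := hasSum_integral_of_summable_integral_norm (μ := volume.restrict S)
      (F := fun (m : d → ℤ) x => e x * f (x + intVec m)) (fun m => ?_) ?_
    · rw [key.tsum_eq]
      refine integral_congr_ae (Eventually.of_forall fun x => ?_)
      change mFourier (-n) (torusMk x) • G (torusMk x) = _
      rw [hem, hG, smul_eq_mul, ← tsum_mul_left]
    · refine Measure.integrableOn_of_bounded hSf.ne (M := u m) ?_ ?_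
      · exact (hec.mul (hc.comp (continuous_id.add continuous_const))).aestronglyMeasurable
      · filter_upwards [ae_restrict_mem hSm] with x hx
        rw [norm_mul, hen, one_mul]
        exact hfu x (hSb x hx) m
    · refine Summable.of_nonneg_of_le (fun m => integral_nonneg fun x => norm_nonneg _) (fun m => ?_)
        (hu.mul_right (volume.real S))
      refine (le_abs_self _).trans ?_
      rw [← Real.norm_eq_abs]
      refine norm_setIntegral_le_of_norm_le_const hSf fun x hx => ?_
      rw [norm_norm, norm_mul, hen, one_mul]
      exact hfu x (hSb x hx) m
  have hsum : Summable (mFourierCoeff G) := by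
    refine hs.congr fun n => (hcoef n).symm
  -- Summable coefficients make the Fourier series of the continuous `G` converge to it pointwise;
  -- its value at the origin is the formula.
  have h0 := (hasSum_mFourier_series_apply_of_summable hsum (torusMk 0)).tsum_eq
  rw [hG] at h0
  simp only [hg, zero_add] at h0
  rw [← h0]
  refine tsum_congr fun n => ?_
  rw [mFourier_torusMk, hcoef]
  simp

end Poisson

/-! ### Gaussians and the theta inversion formula of a quadratic form -/

section GaussianTheta

open Matrix

variable {d : Type*} [Fintype d]

/-- Every finite set of integral vectors lies in a box, over which the sum factors into
one-dimensional sums. -/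
lemma summable_exp_neg_mul_sum_sq {c : ℝ} (hc : 0 < c) :
    Summable fun m : d → ℤ => Real.exp (-c * ∑ i, (m i : ℝ) ^ 2) := by
  classical
  have h1 : Summable fun k : ℤ => Real.exp (-c * (k : ℝ) ^ 2) := by
    refine (summable_pow_mul_jacobiTheta₂_term_bound 0 (div_pos hc Real.pi_pos) 0).congr
      fun k => ?_
    rw [pow_zero, one_mul]
    congr 1
    field_simp
    simp
  refine summable_of_sum_le (c := (∑' k : ℤ, Real.exp (-c * (k : ℝ) ^ 2)) ^ Fintype.card d)
    (fun m => (Real.exp_pos _).le) fun s => ?_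
  set t : d → Finset ℤ := fun i => s.image fun m => m i with ht
  have hsub : s ⊆ Fintype.piFinset t := fun m hm =>
    Fintype.mem_piFinset.2 fun i => Finset.mem_image_of_mem _ hm
  have hprod : ∑ m ∈ Fintype.piFinset t, ∏ i, Real.exp (-c * (m i : ℝ) ^ 2) =
      ∏ i, ∑ k ∈ t i, Real.exp (-c * (k : ℝ) ^ 2) :=
    (Finset.prod_univ_sum t fun _ k => Real.exp (-c * (k : ℝ) ^ 2)).symm
  have hle : ∏ i, ∑ k ∈ t i, Real.exp (-c * (k : ℝ) ^ 2) ≤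
      ∏ _i : d, ∑' k : ℤ, Real.exp (-c * (k : ℝ) ^ 2) :=
    Finset.prod_le_prod (fun i _ => Finset.sum_nonneg fun _ _ => (Real.exp_pos _).le)
      fun i _ => h1.sum_le_tsum _ fun _ _ => (Real.exp_pos _).le
  rw [Finset.prod_const, Finset.card_univ] at hle
  refine le_trans ?_ (hprod.trans_le hle)
  simp only [Finset.mul_sum, Real.exp_sum]
  exact Finset.sum_le_sum_of_subset_of_nonneg hsub
    fun m _ _ => Finset.prod_nonneg fun _ _ => (Real.exp_pos _).le

/-- The quadratic form of a matrix. -/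
def quadForm (A : Matrix d d ℝ) (x : d → ℝ) : ℝ := x ⬝ᵥ A *ᵥ x

variable [DecidableEq d]

lemma exists_sqrt_of_posDef {A : Matrix d d ℝ} (hA : A.PosDef) :
    ∃ M : Matrix d d ℝ, A = Mᵀ * M ∧ M.det ≠ 0 := by
  open scoped MatrixOrder in
  obtain ⟨M, hM⟩ := CStarAlgebra.nonneg_iff_eq_star_mul_self.mp hA.posSemidef.nonneg
  have hM' : A = Mᵀ * M := by
    rw [hM]
    simp [star_eq_conjTranspose]
  refine ⟨M, hM', fun h => hA.det_pos.ne' ?_⟩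
  rw [hM', det_mul, h, mul_zero]

omit [DecidableEq d] in
lemma quadForm_transpose_mul_self (M : Matrix d d ℝ) (x : d → ℝ) :
    quadForm (Mᵀ * M) x = ∑ i, (M *ᵥ x) i ^ 2 := by
  rw [quadForm, ← mulVec_mulVec, dotProduct_mulVec, vecMul_transpose, dotProduct]
  simp [sq]

/-- Write A = MᵀM with M invertible; then x = M⁻¹(Mx) is controlled by Mx through the operator norm
of M⁻¹. That norm refers to the sup norm, and passing to sums of squares costs the factor
`Fintype.card d`. -/
lemma exists_le_quadForm {A : Matrix d d ℝ} (hA : A.PosDef) :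
    ∃ c : ℝ, 0 < c ∧ ∀ x : d → ℝ, c * ∑ i, x i ^ 2 ≤ quadForm A x := by
  obtain ⟨M, rfl, hM⟩ := exists_sqrt_of_posDef hA
  set K : ℝ := ‖(toLin' M⁻¹).toContinuousLinearMap‖ with hK
  have hx : ∀ x : d → ℝ, ‖x‖ ≤ K * ‖M *ᵥ x‖ := by
    intro x
    have := (toLin' M⁻¹).toContinuousLinearMap.le_opNorm (M *ᵥ x)
    simpa [mulVec_mulVec, nonsing_inv_mul _ (isUnit_iff_ne_zero.2 hM)] using this
  have hsq : ∀ x : d → ℝ, ‖x‖ ^ 2 ≤ ∑ i, x i ^ 2 := by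
    intro x
    have hS : 0 ≤ ∑ i, x i ^ 2 := Finset.sum_nonneg fun _ _ => sq_nonneg _
    refine (Real.le_sqrt (norm_nonneg _) hS).1 ((pi_norm_le_iff_of_nonneg (Real.sqrt_nonneg _)).2
      fun i => Real.le_sqrt_of_sq_le ?_)
    rw [Real.norm_eq_abs, sq_abs]
    exact Finset.single_le_sum (f := fun i => x i ^ 2) (fun i _ => sq_nonneg _) (Finset.mem_univ i)
  have hsq' : ∀ x : d → ℝ, ∑ i, x i ^ 2 ≤ Fintype.card d * ‖x‖ ^ 2 := by
    intro x
    calc ∑ i, x i ^ 2 ≤ ∑ _i : d, ‖x‖ ^ 2 := Finset.sum_le_sum fun i _ => by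
          rw [← sq_abs]
          exact pow_le_pow_left₀ (abs_nonneg _) (norm_le_pi_norm x i) 2
      _ = _ := by simp
  have hD : 0 < (Fintype.card d : ℝ) * K ^ 2 + 1 := by positivity
  refine ⟨((Fintype.card d : ℝ) * K ^ 2 + 1)⁻¹, inv_pos.2 hD, fun x => ?_⟩
  rw [quadForm_transpose_mul_self, inv_mul_le_iff₀ hD]
  have h1 := hsq' x
  have h2 : ‖x‖ ^ 2 ≤ K ^ 2 * ‖M *ᵥ x‖ ^ 2 := by
    rw [← mul_pow]
    exact pow_le_pow_left₀ (norm_nonneg _) (hx x) 2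
  have h3 := hsq (M *ᵥ x)
  calc ∑ i, x i ^ 2 ≤ Fintype.card d * (K ^ 2 * ∑ i, (M *ᵥ x) i ^ 2) := by
        refine h1.trans ?_
        gcongr
        exact h2.trans (by gcongr)
    _ ≤ _ := by
        have : 0 ≤ ∑ i, (M *ᵥ x) i ^ 2 := Finset.sum_nonneg fun _ _ => sq_nonneg _
        nlinarith

lemma summable_exp_neg_quadForm {A : Matrix d d ℝ} (hA : A.PosDef) {t : ℝ} (ht : 0 < t) :
    Summable fun m : d → ℤ => Real.exp (-t * quadForm A (intVec m)) := by
  obtain ⟨c, hc, h⟩ := exists_le_quadForm hA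
  refine Summable.of_nonneg_of_le (fun _ => (Real.exp_pos _).le) (fun m => ?_)
    (summable_exp_neg_mul_sum_sq (mul_pos ht hc))
  refine Real.exp_le_exp.2 ?_
  have := mul_le_mul_of_nonneg_left (h (intVec m)) ht.le
  simp only [intVec] at this ⊢
  linarith

/-- Half of the parallelogram inequality. -/
lemma quadForm_le_two_mul_add {A : Matrix d d ℝ} (hA : A.PosDef) (x y : d → ℝ) :
    quadForm A y ≤ 2 * quadForm A (x + y) + 2 * quadForm A x := by
  obtain ⟨M, rfl, hM⟩ := exists_sqrt_of_posDef hA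
  simp only [quadForm_transpose_mul_self, mulVec_add, Finset.mul_sum, ← Finset.sum_add_distrib]
  refine Finset.sum_le_sum fun i _ => ?_
  simp only [Pi.add_apply]
  nlinarith [sq_nonneg (2 * (M *ᵥ x) i + (M *ᵥ y) i)]

omit [DecidableEq d] in
lemma continuous_quadForm (A : Matrix d d ℝ) : Continuous (quadForm A) := by
  unfold quadForm
  fun_prop

/-- The change of variables `x ↦ M x` in an integral over `ℝᵈ`. -/
lemma integral_comp_mulVec {M : Matrix d d ℝ} (hM : M.det ≠ 0) (f : (d → ℝ) → ℂ) :
    ∫ x, f (M *ᵥ x) = |M.det|⁻¹ * ∫ x, f x := by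
  have h := Real.map_matrix_volume_pi_eq_smul_volume_pi hM
  have hdet : LinearMap.det (toLin' M) ≠ 0 := by rwa [LinearMap.det_toLin']
  have he : MeasurableEmbedding (toLin' M) :=
    ((toLin' M).equivOfDetNeZero hdet).toContinuousLinearEquiv.toHomeomorph.measurableEmbedding
  have := he.integral_map (μ := volume) f
  rw [h, integral_smul_measure, ENNReal.toReal_ofReal (abs_nonneg _), abs_inv] at this
  simpa using this.symm

/-- The Fourier transform of a Gaussian. -/
lemma integral_exp_mul_gaussian {A : Matrix d d ℝ} (hA : A.PosDef) (k : d → ℝ) :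
    ∫ x : d → ℝ, Complex.exp (-(2 * Real.pi * Complex.I * ∑ i, (k i : ℂ) * x i)) *
      ((Real.exp (-Real.pi * quadForm A x) : ℝ) : ℂ) =
    ((A.det ^ (-(1 / 2) : ℝ) * Real.exp (-Real.pi * quadForm A⁻¹ k) : ℝ) : ℂ) := by
  obtain ⟨M, rfl, hM⟩ := exists_sqrt_of_posDef hA
  have hMu : IsUnit M.det := isUnit_iff_ne_zero.2 hM
  -- The frequency in the coordinates z = Mx, where the Gaussian becomes the standard one; the
  -- squared length of `k'` is the inverse form at `k`.
  set k' : d → ℝ := k ᵥ* M⁻¹ with hk'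
  have hk : ∀ x : d → ℝ, ∑ i, (k i : ℂ) * x i = ∑ i, (k' i : ℂ) * (M *ᵥ x) i := by
    intro x
    have : k ⬝ᵥ x = k' ⬝ᵥ M *ᵥ x := by
      rw [hk', ← dotProduct_mulVec, mulVec_mulVec, nonsing_inv_mul _ hMu, one_mulVec]
    simp only [dotProduct] at this
    exact_mod_cast this
  have hq : quadForm (Mᵀ * M)⁻¹ k = ∑ i, k' i ^ 2 := by
    rw [quadForm, Matrix.mul_inv_rev, ← mulVec_mulVec, dotProduct_mulVec, ← transpose_nonsing_inv,
      mulVec_transpose, dotProduct]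
    simp [sq, hk']
  have h1 := integral_comp_mulVec hM fun z => Complex.exp (-(Real.pi : ℂ) * ∑ i, (z i : ℂ) ^ 2 +
    ∑ i, (-(2 * Real.pi * Complex.I * k' i)) * z i)
  have hpi : 0 < (Real.pi : ℂ).re := by simpa using Real.pi_pos
  rw [GaussianFourier.integral_cexp_neg_mul_sum_add hpi, div_self (by simp [Real.pi_ne_zero]),
    Complex.one_cpow, one_mul] at h1
  have h2 : (Mᵀ * M).det ^ (-(1 / 2) : ℝ) = |M.det|⁻¹ := by
    rw [det_mul, det_transpose, ← sq, ← sq_abs, ← Real.rpow_natCast, ← Real.rpow_mul (abs_nonneg _)]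
    norm_num
    rw [Real.rpow_neg_one]
  rw [h2, hq]
  refine Eq.trans ?_ (h1.trans ?_)
  · refine integral_congr_ae (Eventually.of_forall fun x => ?_)
    simp only
    rw [quadForm_transpose_mul_self, Complex.ofReal_exp, ← Complex.exp_add, hk]
    congr 1
    push_cast
    rw [add_comm, Finset.mul_sum (a := 2 * (Real.pi : ℂ) * Complex.I), ← Finset.sum_neg_distrib]
    congr 1
    exact Finset.sum_congr rfl fun i _ => by ring
  · push_cast
    congr 2
    have hp : (Real.pi : ℂ) ≠ 0 := by simp [Real.pi_ne_zero]
    rw [Finset.sum_div, Finset.mul_sum]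
    refine Finset.sum_congr rfl fun i _ => ?_
    field_simp
    rw [Complex.I_sq]
    ring

/-- A non-integrable function has Bochner integral 0, whereas the Fourier formula at frequency 0
gives a positive number. -/
lemma integrable_gaussian {A : Matrix d d ℝ} (hA : A.PosDef) :
    Integrable fun x : d → ℝ => ((Real.exp (-Real.pi * quadForm A x) : ℝ) : ℂ) := by
  by_contra h
  have := integral_exp_mul_gaussian hA 0
  simp only [Pi.zero_apply, Complex.ofReal_zero, zero_mul, Finset.sum_const_zero, mul_zero,
    neg_zero, Complex.exp_zero, one_mul] at this
  rw [integral_undef h] at this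
  have hpos : 0 < A.det ^ (-(1 / 2) : ℝ) * Real.exp (-Real.pi * quadForm A⁻¹ 0) :=
    mul_pos (Real.rpow_pos_of_pos hA.det_pos _) (Real.exp_pos _)
  exact hpos.ne (by exact_mod_cast this)

/-- The **theta inversion formula** for a positive definite quadratic form. -/
theorem tsum_exp_neg_quadForm {A : Matrix d d ℝ} (hA : A.PosDef) :
    ∑' m : d → ℤ, Real.exp (-Real.pi * quadForm A (intVec m)) =
      A.det ^ (-(1 / 2) : ℝ) * ∑' m : d → ℤ, Real.exp (-Real.pi * quadForm A⁻¹ (intVec m)) := by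
  have hinv := summable_exp_neg_quadForm hA.inv Real.pi_pos
  have hF : ∀ m : d → ℤ,
      ∫ x : d → ℝ, Complex.exp (-(2 * Real.pi * Complex.I * ∑ i, (m i : ℂ) * x i)) *
        ((Real.exp (-Real.pi * quadForm A x) : ℝ) : ℂ) =
      ((A.det ^ (-(1 / 2) : ℝ) * Real.exp (-Real.pi * quadForm A⁻¹ (intVec m)) : ℝ) : ℂ) := by
    intro m
    rw [← integral_exp_mul_gaussian hA (intVec m)]
    simp
  have key := tsum_eq_tsum_fourier (d := d)
    (fun x => ((Real.exp (-Real.pi * quadForm A x) : ℝ) : ℂ)) ?_ (integrable_gaussian hA) ?_ ?_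
  · simp only [hF] at key
    rw [← tsum_mul_left]
    exact_mod_cast key
  · exact Complex.continuous_ofReal.comp
      (Real.continuous_exp.comp (continuous_const.mul (continuous_quadForm A)))
  · intro R
    obtain ⟨C, hC⟩ := (isCompact_closedBall (0 : d → ℝ) R).bddAbove_image
      (continuous_quadForm A).continuousOn
    -- From q(m) ≤ 2q(x+m) + 2q(x) and q(x) ≤ C one has q(x+m) ≥ q(m)/2 - C; hence the halved rate
    -- and the factor exp(πC).
    refine ⟨fun m => Real.exp (Real.pi * C) * Real.exp (-(Real.pi / 2) * quadForm A (intVec m)),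
      (summable_exp_neg_quadForm hA (by positivity)).mul_left _, fun x hx m => ?_⟩
    simp only
    rw [Complex.norm_real, Real.norm_eq_abs, abs_of_pos (Real.exp_pos _), ← Real.exp_add]
    refine Real.exp_le_exp.2 ?_
    have h1 := quadForm_le_two_mul_add hA x (intVec m)
    have h2 : quadForm A x ≤ C := hC ⟨x, by simpa using hx, rfl⟩
    have h3 : 0 ≤ Real.pi * (2 * quadForm A (x + intVec m) + 2 * C - quadForm A (intVec m)) :=
      mul_nonneg Real.pi_pos.le (by linarith)
    linarith
  · simp only [hF]
    exact Complex.ofRealCLM.summable (hinv.mul_left _)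

end GaussianTheta

/-! ### Gram matrices of ideals and theta inversion for fractional ideals -/

section IdealTheta

open Matrix Module

variable {F : Type*} [Field F] [NumberField F]

/-- The weight `y_τ` of an embedding, for the logarithmic coordinates `u_v = log y_v ^ n_v`. -/
def embWeight (u : InfinitePlace F → ℝ) (τ : F →+* ℂ) : ℝ :=
  Real.exp (u (InfinitePlace.mk τ) / (InfinitePlace.mk τ).mult)

/-- The quadratic form `∑_τ y_τ |τ x|²` on `F`. -/
def embForm (u : InfinitePlace F → ℝ) (x : F) : ℝ := ∑ τ : F →+* ℂ, embWeight u τ * ‖τ x‖ ^ 2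

omit [NumberField F] in
lemma embWeight_pos (u : InfinitePlace F → ℝ) (τ : F →+* ℂ) : 0 < embWeight u τ := Real.exp_pos _

omit [NumberField F] in
lemma embWeight_neg (u : InfinitePlace F → ℝ) (τ : F →+* ℂ) :
    embWeight (-u) τ = (embWeight u τ)⁻¹ := by
  rw [embWeight, embWeight, ← Real.exp_neg, Pi.neg_apply, neg_div]

lemma sum_embeddings_comp_mk (f : InfinitePlace F → ℝ) :
    ∑ τ : F →+* ℂ, f (InfinitePlace.mk τ) = ∑ v : InfinitePlace F, v.mult * f v := by
  classical
  rw [← Finset.sum_fiberwise Finset.univ InfinitePlace.mk]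
  refine Finset.sum_congr rfl fun v _ => ?_
  rw [Finset.sum_congr rfl (g := fun _ => f v) fun τ hτ => by rw [(Finset.mem_filter.1 hτ).2],
    Finset.sum_const, InfinitePlace.card_filter_mk_eq, nsmul_eq_mul]

lemma prod_embWeight (u : InfinitePlace F → ℝ) :
    ∏ τ : F →+* ℂ, embWeight u τ = Real.exp (∑ v, u v) := by
  simp only [embWeight]
  rw [← Real.exp_sum, sum_embeddings_comp_mk fun v => u v / v.mult]
  congr 1
  exact Finset.sum_congr rfl fun v _ => mul_div_cancel₀ _ InfinitePlace.mult_coe_ne_zero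

variable {ι : Type*} [Fintype ι]

/-- The Gram matrix of a family with respect to `embForm u`. -/
def embGram (b : ι → F) (u : InfinitePlace F → ℝ) : Matrix ι ι ℝ :=
  of fun i j => ∑ τ : F →+* ℂ, embWeight u τ * (star (τ (b i)) * τ (b j)).re

omit [NumberField F] in
lemma norm_sq_sum (τ : F →+* ℂ) (b : ι → F) (x : ι → ℝ) :
    ‖∑ i, (x i : ℂ) * τ (b i)‖ ^ 2 = ∑ i, ∑ j, x i * x j * (star (τ (b i)) * τ (b j)).re := by
  have h : ((‖∑ i, (x i : ℂ) * τ (b i)‖ ^ 2 : ℝ) : ℂ) =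
      ∑ i, ∑ j, (x i : ℂ) * x j * (star (τ (b i)) * τ (b j)) := by
    push_cast
    rw [← Complex.conj_mul', map_sum, Finset.sum_mul_sum]
    refine Finset.sum_congr rfl fun i _ => Finset.sum_congr rfl fun j _ => ?_
    simp only [map_mul, Complex.conj_ofReal, ← starRingEnd_apply]
    ring
  have h' := congrArg Complex.re h
  rw [Complex.ofReal_re, Complex.re_sum] at h'
  rw [h']
  refine Finset.sum_congr rfl fun i _ => ?_
  rw [Complex.re_sum]
  refine Finset.sum_congr rfl fun j _ => ?_
  rw [← Complex.ofReal_mul, Complex.re_ofReal_mul]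

lemma quadForm_embGram (b : ι → F) (u : InfinitePlace F → ℝ) (x : ι → ℝ) :
    quadForm (embGram b u) x = ∑ τ : F →+* ℂ, embWeight u τ * ‖∑ i, (x i : ℂ) * τ (b i)‖ ^ 2 := by
  simp only [norm_sq_sum, quadForm, dotProduct, mulVec, embGram, of_apply, Finset.mul_sum,
    Finset.sum_mul]
  refine Eq.trans ?_ Finset.sum_comm
  refine Finset.sum_congr rfl fun i _ => Eq.trans ?_ Finset.sum_comm
  exact Finset.sum_congr rfl fun j _ => Finset.sum_congr rfl fun τ _ => by ring

lemma quadForm_embGram_intVec (b : ι → F) (u : InfinitePlace F → ℝ) (m : ι → ℤ) :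
    quadForm (embGram b u) (intVec m) = embForm u (∑ i, m i • b i) := by
  rw [quadForm_embGram, embForm]
  refine Finset.sum_congr rfl fun τ _ => ?_
  simp [map_sum]

/-- The matrix `(τ b_j)` of a family, the embeddings being numbered by `e`. -/
def embMatrix (e : ι ≃ (F →+* ℂ)) (b : ι → F) : Matrix ι ι ℂ := of fun k j => e k (b j)

variable [DecidableEq ι]

/-- Conjugate embeddings carry equal weights, so the entries of BᴴDB are already real, and the real
parts in `embGram` lose nothing. -/
lemma embGram_map_ofReal (e : ι ≃ (F →+* ℂ)) (b : ι → F) (u : InfinitePlace F → ℝ) :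
    (embGram b u).map ((↑) : ℝ → ℂ) =
      (embMatrix e b)ᴴ * diagonal (fun k => (embWeight u (e k) : ℂ)) * embMatrix e b := by
  ext i j
  have h1 : ((embMatrix e b)ᴴ * diagonal (fun k => (embWeight u (e k) : ℂ)) * embMatrix e b) i j =
      ∑ τ : F →+* ℂ, (embWeight u τ : ℂ) * (star (τ (b i)) * τ (b j)) := by
    rw [mul_apply, ← e.sum_comp]
    refine Finset.sum_congr rfl fun k _ => ?_
    rw [mul_diagonal, conjTranspose_apply, embMatrix, of_apply, of_apply]
    ring
  rw [h1]
  set S := ∑ τ : F →+* ℂ, (embWeight u τ : ℂ) * (star (τ (b i)) * τ (b j)) with hS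
  have hre : S.re = embGram b u i j := by
    rw [hS, Complex.re_sum]
    exact Finset.sum_congr rfl fun τ _ => by rw [Complex.re_ofReal_mul]
  have him : (starRingEnd ℂ) S = S := by
    rw [hS, map_sum]
    refine Fintype.sum_equiv (ComplexEmbedding.involutive_conjugate F).toPerm _ _ fun τ => ?_
    have : embWeight u (ComplexEmbedding.conjugate τ) = embWeight u τ := by
      rw [embWeight, embWeight, InfinitePlace.mk_conjugate_eq]
    simp only [Function.Involutive.coe_toPerm, this, ComplexEmbedding.conjugate_coe_eq, map_mul,
      Complex.conj_ofReal, ← starRingEnd_apply]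
  rw [map_apply, ← hre]
  exact (Complex.conj_eq_iff_re.1 him)

omit [DecidableEq ι] in
lemma embMatrix_transpose_mul (e : ι ≃ (F →+* ℂ)) (b b' : ι → F) (i j : ι) :
    ((embMatrix e b)ᵀ * embMatrix e b') i j = (Algebra.trace ℚ F (b i * b' j) : ℂ) := by
  have := trace_eq_sum_embeddings (K := ℚ) (L := F) ℂ (x := b i * b' j)
  rw [eq_ratCast] at this
  rw [this, ← (e.trans (RingHom.equivRatAlgHom F ℂ)).sum_comp, mul_apply]
  refine Finset.sum_congr rfl fun k _ => ?_
  rw [transpose_apply, embMatrix, embMatrix, of_apply, of_apply, ← map_mul]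
  rfl

/-- With the plain transpose in place of the adjoint, BᵀB is the trace matrix. -/
lemma det_embMatrix_sq (e : ι ≃ (F →+* ℂ)) (b : ι → F) :
    (embMatrix e b).det ^ 2 = (Algebra.discr ℚ b : ℂ) := by
  have : (embMatrix e b)ᵀ * embMatrix e b = (Algebra.traceMatrix ℚ b).map (algebraMap ℚ ℂ) := by
    ext i j
    rw [embMatrix_transpose_mul]
    simp [Algebra.traceMatrix, Algebra.traceForm_apply]
  have h := congrArg det this
  rw [det_mul, det_transpose, ← sq] at h
  rw [h, Algebra.discr_def, ← RingHom.mapMatrix_apply, ← RingHom.map_det, eq_ratCast]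

omit [DecidableEq ι] in
lemma exists_embEquiv (b : Basis ι ℚ F) : Nonempty (ι ≃ (F →+* ℂ)) :=
  ⟨Fintype.equivOfCardEq (by
    rw [Embeddings.card, Module.finrank_eq_card_basis b])⟩

lemma det_embMatrix_ne_zero (e : ι ≃ (F →+* ℂ)) (b : Basis ι ℚ F) : (embMatrix e b).det ≠ 0 := by
  intro h
  have := det_embMatrix_sq e b
  rw [h, zero_pow two_ne_zero] at this
  exact Algebra.discr_not_zero_of_basis ℚ b (by exact_mod_cast this.symm)

lemma det_embGram (b : Basis ι ℚ F) (u : InfinitePlace F → ℝ) :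
    (embGram b u).det = |((Algebra.discr ℚ b : ℚ) : ℝ)| * Real.exp (∑ v, u v) := by
  obtain ⟨e⟩ := exists_embEquiv b
  have h := congrArg det (embGram_map_ofReal e b u)
  have h1 : ((embGram b u).map ((↑) : ℝ → ℂ)).det = ((embGram b u).det : ℂ) := by
    exact (RingHom.map_det Complex.ofRealHom (embGram b u)).symm
  have h2 : (∏ k, (embWeight u (e k) : ℂ)) = ((Real.exp (∑ v, u v) : ℝ) : ℂ) := by
    rw [← prod_embWeight, ← e.prod_comp]
    push_cast
    rfl
  have h3 : star (embMatrix e b).det * (embMatrix e b).det =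
      ((|((Algebra.discr ℚ b : ℚ) : ℝ)| : ℝ) : ℂ) := by
    rw [← starRingEnd_apply, Complex.conj_mul', ← Complex.ofReal_pow, ← norm_pow,
      det_embMatrix_sq]
    norm_cast
  rw [h1, det_mul, det_mul, det_conjTranspose, det_diagonal, h2, mul_right_comm, h3] at h
  exact_mod_cast h

/-- The form is a sum of positively weighted squares of the entries of Bx, and B is nonsingular
because the discriminant of a basis does not vanish. -/
lemma posDef_embGram (b : Basis ι ℚ F) (u : InfinitePlace F → ℝ) : (embGram b u).PosDef := by
  obtain ⟨e⟩ := exists_embEquiv b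
  refine PosDef.of_dotProduct_mulVec_pos ?_ fun x hx => ?_
  · ext i j
    rw [conjTranspose_apply, star_trivial, embGram, of_apply, of_apply]
    refine Finset.sum_congr rfl fun τ _ => ?_
    rw [← Complex.conj_re (star (τ (b i)) * τ (b j))]
    simp only [map_mul, ← starRingEnd_apply, Complex.conj_conj]
    rw [mul_comm (τ (b i))]
  · have hq := quadForm_embGram b u x
    rw [star_trivial]
    change 0 < quadForm (embGram b u) x
    rw [hq]
    refine Finset.sum_pos' (fun τ _ => mul_nonneg (embWeight_pos u τ).le (sq_nonneg _)) ?_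
    by_contra! hcon
    have hz : ∀ τ : F →+* ℂ, ∑ i, (x i : ℂ) * τ (b i) = 0 := by
      intro τ
      have h1 := hcon τ (Finset.mem_univ _)
      have h2 : ‖∑ i, (x i : ℂ) * τ (b i)‖ ^ 2 ≤ 0 := by
        by_contra! h
        exact absurd (mul_pos (embWeight_pos u τ) h) (not_lt.2 h1)
      simpa using pow_eq_zero_iff two_ne_zero |>.1 (le_antisymm h2 (sq_nonneg _))
    have hmul : embMatrix e b *ᵥ (fun i => (x i : ℂ)) = 0 := by
      ext k
      rw [mulVec, dotProduct, Pi.zero_apply, ← hz (e k)]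
      exact Finset.sum_congr rfl fun i _ => mul_comm _ _
    have := eq_zero_of_mulVec_eq_zero (det_embMatrix_ne_zero e b) hmul
    exact hx (funext fun i => by simpa using congrFun this i)

/-- Trace duality says B'ᵀB = 1, so inverting BᴴDB replaces B by the matrix of the dual basis and
the weights by their reciprocals. -/
lemma embGram_inv (b : Basis ι ℚ F) (u : InfinitePlace F → ℝ) :
    (embGram b u)⁻¹ = embGram b.traceDual (-u) := by
  obtain ⟨e⟩ := exists_embEquiv b
  refine inv_eq_right_inv ?_
  set B := embMatrix e b with hB
  set B' := embMatrix e b.traceDual with hB'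
  have h1 : B'ᵀ * B = 1 := by
    ext i j
    rw [embMatrix_transpose_mul, Basis.trace_traceDual_mul, one_apply]
    split_ifs with h1 h2 h2 <;> simp_all
  have h2 : B * B'ᵀ = 1 := mul_eq_one_comm.1 h1
  have hinj : Function.Injective fun M : Matrix ι ι ℝ => M.map ((↑) : ℝ → ℂ) :=
    map_injective Complex.ofReal_injective
  refine hinj ?_
  -- The Gram matrix equals its transpose; transposing B'ᴴD⁻¹B' puts B'ᵀ on the left, where it meets
  -- B in the product.
  have hsymm : (embGram b.traceDual (-u)).map ((↑) : ℝ → ℂ) =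
      B'ᵀ * diagonal (fun k => (embWeight (-u) (e k) : ℂ)) * B'ᵀᴴ := by
    have h := embGram_map_ofReal e b.traceDual (-u)
    have hT : (embGram b.traceDual (-u)).map ((↑) : ℝ → ℂ) =
        ((embGram b.traceDual (-u)).map ((↑) : ℝ → ℂ))ᵀ := by
      have := (posDef_embGram b.traceDual (-u)).1
      rw [IsHermitian, conjTranspose_eq_transpose_of_trivial] at this
      rw [← transpose_map, this]
    rw [hT, h, transpose_mul, transpose_mul, diagonal_transpose, ← mul_assoc]
    rfl
  have hd : diagonal (fun k => (embWeight u (e k) : ℂ)) *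
      diagonal (fun k => (embWeight (-u) (e k) : ℂ)) = 1 := by
    rw [diagonal_mul_diagonal, ← diagonal_one]
    congr 1
    funext k
    rw [embWeight_neg, Complex.ofReal_inv, mul_inv_cancel₀]
    exact_mod_cast (embWeight_pos u (e k)).ne'
  have hmap : (embGram b u * embGram b.traceDual (-u)).map ((↑) : ℝ → ℂ) =
      (embGram b u).map ((↑) : ℝ → ℂ) * (embGram b.traceDual (-u)).map ((↑) : ℝ → ℂ) :=
    Matrix.map_mul (f := Complex.ofRealHom)
  have hone : (1 : Matrix ι ι ℝ).map ((↑) : ℝ → ℂ) = 1 :=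
    Matrix.map_one _ Complex.ofReal_zero Complex.ofReal_one
  simp only
  rw [hmap, hone, hsymm, embGram_map_ofReal e, ← hB]
  calc Bᴴ * diagonal (fun k => (embWeight u (e k) : ℂ)) * B *
      (B'ᵀ * diagonal (fun k => (embWeight (-u) (e k) : ℂ)) * B'ᵀᴴ)
      = Bᴴ * (diagonal (fun k => (embWeight u (e k) : ℂ)) * (B * B'ᵀ) *
          diagonal (fun k => (embWeight (-u) (e k) : ℂ))) * B'ᵀᴴ := by simp only [mul_assoc]
    _ = 1 := by rw [h2, mul_one, hd, mul_one, ← conjTranspose_mul, h1, conjTranspose_one]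

/-- The theta series of a fractional ideal. -/
def idealTheta (J : FractionalIdeal (𝓞 F)⁰ F) (u : InfinitePlace F → ℝ) : ℝ :=
  ∑' x : {x : F // x ∈ J}, Real.exp (-Real.pi * embForm u (x : F))

/-- The coordinates of the elements of a fractional ideal. -/
def coordEquiv (J : FractionalIdeal (𝓞 F)⁰ F) (b : Basis ι ℚ F)
    (h : ∀ x, x ∈ J ↔ x ∈ Submodule.span ℤ (Set.range b)) : (ι → ℤ) ≃ {x : F // x ∈ J} :=
  (b.restrictScalars ℤ).equivFun.symm.toEquiv.trans (Equiv.subtypeEquivRight fun x => (h x).symm)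

omit [DecidableEq ι] in
lemma coe_coordEquiv (J : FractionalIdeal (𝓞 F)⁰ F) (b : Basis ι ℚ F)
    (h : ∀ x, x ∈ J ↔ x ∈ Submodule.span ℤ (Set.range b)) (m : ι → ℤ) :
    (coordEquiv J b h m : F) = ∑ i, m i • b i := by
  change (((b.restrictScalars ℤ).equivFun.symm m : Submodule.span ℤ (Set.range b)) : F) = _
  rw [Basis.equivFun_symm_apply]
  simp [Basis.restrictScalars_apply]

omit [DecidableEq ι] in
lemma idealTheta_eq_tsum (J : FractionalIdeal (𝓞 F)⁰ F) (b : Basis ι ℚ F)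
    (h : ∀ x, x ∈ J ↔ x ∈ Submodule.span ℤ (Set.range b)) (u : InfinitePlace F → ℝ) :
    idealTheta J u = ∑' m : ι → ℤ, Real.exp (-Real.pi * quadForm (embGram b u) (intVec m)) := by
  rw [idealTheta, ← (coordEquiv J b h).tsum_eq]
  simp only [coe_coordEquiv, quadForm_embGram_intVec]

/-- The absolute value of the discriminant of a `ℤ`-basis of the fractional ideal. -/
def idealDisc (J : FractionalIdeal (𝓞 F)⁰ F) : ℝ :=
  |(discr F : ℝ)| * (FractionalIdeal.absNorm J : ℝ) ^ 2

omit [Fintype ι] [DecidableEq ι] in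
lemma mem_dual_iff_mem_span [Finite ι] [DecidableEq ι]
    (J : (FractionalIdeal (𝓞 F)⁰ F)ˣ) (b : Basis ι ℚ F)
    (h : ∀ x, x ∈ (J : FractionalIdeal (𝓞 F)⁰ F) ↔ x ∈ Submodule.span ℤ (Set.range b)) (x : F) :
    x ∈ FractionalIdeal.dual ℤ ℚ (J : FractionalIdeal (𝓞 F)⁰ F) ↔
      x ∈ Submodule.span ℤ (Set.range b.traceDual) := by
  have h1 := Submodule.traceDual_span_of_basis ℤ
    ((J : FractionalIdeal (𝓞 F)⁰ F) : Submodule (𝓞 F) F) b (Submodule.ext fun y => h y)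
  rw [← h1, ← FractionalIdeal.coe_dual ℤ ℚ J.ne_zero]
  rfl

/-- The change of basis from an integral basis of the field has determinant ±N(J), and discriminants
scale by the square of the determinant. -/
lemma abs_discr_basisOfFractionalIdeal (J : (FractionalIdeal (𝓞 F)⁰ F)ˣ) :
    |((Algebra.discr ℚ (basisOfFractionalIdeal F J) : ℚ) : ℝ)| =
      idealDisc (J : FractionalIdeal (𝓞 F)⁰ F) := by
  have hcard : Fintype.card (Free.ChooseBasisIndex ℤ (𝓞 F)) =
      Fintype.card (Free.ChooseBasisIndex ℤ J) := by
    rw [← finrank_eq_card_chooseBasisIndex, ← finrank_eq_card_chooseBasisIndex,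
      fractionalIdeal_rank]
  let e := Fintype.equivOfCardEq hcard
  have h1 := det_basisOfFractionalIdeal_eq_absNorm F J e
  set b := (basisOfFractionalIdeal F J).reindex e.symm with hb
  have h2 := Algebra.discr_of_matrix_vecMul (A := ℚ) (integralBasis F)
    ((integralBasis F).toMatrix b)
  rw [Basis.toMatrix_map_vecMul, ← coe_discr, ← Basis.det_apply] at h2
  have h3 : Algebra.discr ℚ b = Algebra.discr ℚ (basisOfFractionalIdeal F J) := by
    rw [hb, Basis.coe_reindex]
    exact Algebra.discr_reindex ℚ (basisOfFractionalIdeal F J) e.symm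
  rw [← h3, h2, idealDisc, ← h1]
  push_cast
  rw [abs_mul, abs_pow, mul_comm]

/-- The **theta inversion formula** for fractional ideals. -/
theorem idealTheta_inversion (J : (FractionalIdeal (𝓞 F)⁰ F)ˣ) (u : InfinitePlace F → ℝ) :
    idealTheta (J : FractionalIdeal (𝓞 F)⁰ F) u =
      (idealDisc (J : FractionalIdeal (𝓞 F)⁰ F) * Real.exp (∑ v, u v)) ^ (-(1 / 2) : ℝ) *
        idealTheta (FractionalIdeal.dual ℤ ℚ (J : FractionalIdeal (𝓞 F)⁰ F)) (-u) := by
  classical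
  set b := basisOfFractionalIdeal F J with hb
  have h : ∀ x, x ∈ (J : FractionalIdeal (𝓞 F)⁰ F) ↔ x ∈ Submodule.span ℤ (Set.range b) :=
    fun x => (mem_span_basisOfFractionalIdeal F).symm
  rw [idealTheta_eq_tsum _ b h, idealTheta_eq_tsum _ b.traceDual (mem_dual_iff_mem_span J b h),
    tsum_exp_neg_quadForm (posDef_embGram b u), det_embGram, abs_discr_basisOfFractionalIdeal,
    embGram_inv]

end IdealTheta

/-! ### Splitting the logarithmic space into norm and hyperplane -/

section LogCoordinates

open Module NumberField.Units.dirichletUnitTheorem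
open scoped Classical

variable {F : Type*} [Field F] [NumberField F]

/-- The logarithmic coordinates with sum `a` that are determined by a point of the hyperplane of
sum zero; the latter is identified with `logSpace F`. -/
def logCoord (a : ℝ) (l : logSpace F) (v : InfinitePlace F) : ℝ :=
  (if h : v = w₀ then -∑ w, l w else l ⟨v, h⟩) + (v.mult : ℝ) / finrank ℚ F * a

lemma logCoord_w₀ (a : ℝ) (l : logSpace F) :
    logCoord a l w₀ = -∑ w, l w + ((w₀ : InfinitePlace F).mult : ℝ) / finrank ℚ F * a := by
  simp [logCoord]

lemma logCoord_ne (a : ℝ) (l : logSpace F) (w : {w : InfinitePlace F // w ≠ w₀}) :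
    logCoord a l w = l w + ((w : InfinitePlace F).mult : ℝ) / finrank ℚ F * a := by
  simp [logCoord, w.2]

lemma finrank_ne_zero_real : (finrank ℚ F : ℝ) ≠ 0 := by
  exact_mod_cast (finrank_pos (R := ℚ) (M := F)).ne'

lemma sum_mult_div_finrank :
    ((w₀ : InfinitePlace F).mult : ℝ) / finrank ℚ F +
      ∑ w : {w : InfinitePlace F // w ≠ w₀}, ((w : InfinitePlace F).mult : ℝ) / finrank ℚ F = 1 := by
  rw [← Fintype.sum_eq_add_sum_subtype_ne
    (fun v : InfinitePlace F => (v.mult : ℝ) / finrank ℚ F), ← Finset.sum_div]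
  have := InfinitePlace.sum_mult_eq (K := F)
  rw [← Nat.cast_sum, this, div_self finrank_ne_zero_real]

lemma sum_logCoord (a : ℝ) (l : logSpace F) : ∑ v, logCoord a l v = a := by
  rw [Fintype.sum_eq_add_sum_subtype_ne _ w₀, logCoord_w₀]
  simp only [logCoord_ne, Finset.sum_add_distrib, ← Finset.sum_mul]
  have := sum_mult_div_finrank (F := F)
  linear_combination a * this

lemma logCoord_add (a a' : ℝ) (l l' : logSpace F) :
    logCoord (a + a') (l + l') = logCoord a l + logCoord a' l' := by
  funext v
  by_cases h : v = w₀
  · subst h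
    simp only [logCoord_w₀, Pi.add_apply, Finset.sum_add_distrib]
    ring
  · have := logCoord_ne (a + a') (l + l') ⟨v, h⟩
    have h1 := logCoord_ne a l ⟨v, h⟩
    have h2 := logCoord_ne a' l' ⟨v, h⟩
    simp only [Pi.add_apply] at this h1 h2 ⊢
    rw [this, h1, h2]
    ring

lemma logCoord_neg (a : ℝ) (l : logSpace F) : logCoord (-a) (-l) = -logCoord a l := by
  have h := logCoord_add a (-a) l (-l)
  have h0 : logCoord (0 : ℝ) (0 : logSpace F) = 0 := by
    funext v
    simp [logCoord]
  rw [add_neg_cancel, add_neg_cancel, h0] at h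
  exact (neg_eq_of_add_eq_zero_right h.symm).symm

/-- The hyperplane component of logarithmic coordinates. -/
def logProj (u : InfinitePlace F → ℝ) : logSpace F :=
  fun w => u w - ((w : InfinitePlace F).mult : ℝ) / finrank ℚ F * ∑ v, u v

lemma logCoord_logProj (u : InfinitePlace F → ℝ) : logCoord (∑ v, u v) (logProj u) = u := by
  have hne : ∀ w : {w : InfinitePlace F // w ≠ w₀},
      logCoord (∑ v, u v) (logProj u) w = u w := fun w => by
    rw [logCoord_ne, logProj]
    ring
  funext v
  by_cases h : v = w₀
  · subst h
    have h1 := sum_logCoord (∑ v, u v) (logProj u)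
    rw [Fintype.sum_eq_add_sum_subtype_ne _ w₀, Fintype.sum_eq_add_sum_subtype_ne u w₀] at h1
    rw [← Fintype.sum_eq_add_sum_subtype_ne u w₀] at h1
    simp only [hne] at h1
    rw [Fintype.sum_eq_add_sum_subtype_ne u w₀] at h1 ⊢
    linarith
  · exact hne ⟨v, h⟩

lemma continuous_logCoord :
    Continuous fun p : ℝ × logSpace F => logCoord p.1 p.2 := by
  refine continuous_pi fun v => ?_
  by_cases h : v = w₀
  · subst h
    simp only [logCoord_w₀]
    fun_prop
  · have : (fun p : ℝ × logSpace F => logCoord p.1 p.2 v) =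
        fun p => p.2 ⟨v, h⟩ + (v.mult : ℝ) / finrank ℚ F * p.1 := by
      funext p
      exact logCoord_ne p.1 p.2 ⟨v, h⟩
    rw [this]
    fun_prop

/-- The map is a composite of two shears and coordinate permutations: l is translated by a multiple
of `c` that depends on a, then ∑ l is subtracted from a to give the coordinate at `w₀`. No Jacobian
factor appears. -/
lemma measurePreserving_logCoord :
    MeasurePreserving (fun p : ℝ × logSpace F => logCoord p.1 p.2) (volume.prod volume) volume := by
  set c : logSpace F := fun w => ((w : InfinitePlace F).mult : ℝ) / finrank ℚ F with hc
  have h1 : MeasurePreserving (fun p : ℝ × logSpace F => (p.1, p.2 + p.1 • c))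
      (volume.prod volume) (volume.prod volume) := by
    refine (MeasurePreserving.id volume).skew_product (g := fun a (l : logSpace F) => l + a • c) ?_
      (Eventually.of_forall fun a => ?_)
    · exact (by fun_prop : Continuous fun p : ℝ × logSpace F => p.2 + p.1 • c).measurable
    · exact (measurePreserving_add_right volume _).map_eq
  have h2 : MeasurePreserving (fun p : logSpace F × ℝ => (p.1, p.2 - ∑ w, p.1 w))
      (volume.prod volume) (volume.prod volume) := by
    refine (MeasurePreserving.id volume).skew_product
      (g := fun (l : logSpace F) a => a - ∑ w, l w) ?_ (Eventually.of_forall fun a => ?_)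
    · exact (by fun_prop : Continuous fun p : logSpace F × ℝ => p.2 - ∑ w, p.1 w).measurable
    · exact (measurePreserving_sub_right volume _).map_eq
  have h3 : MeasurePreserving
      (MeasurableEquiv.piEquivPiSubtypeProd (fun _ : InfinitePlace F => ℝ) (fun v => v = w₀)).symm
      ((volume : Measure ({v : InfinitePlace F // v = w₀} → ℝ)).prod
        (volume : Measure (logSpace F))) volume := by
    convert! (volume_preserving_piEquivPiSubtypeProd (fun _ : InfinitePlace F => ℝ)
      (fun v => v = w₀)).symm
    rw [Measure.volume_eq_prod]
    congr!
  have h4 := (volume_preserving_funUnique {v : InfinitePlace F // v = w₀} ℝ).symm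
  have h5 := h3.comp ((h4.prod (MeasurePreserving.id (volume : Measure (logSpace F)))).comp
    (Measure.measurePreserving_swap.comp (h2.comp (Measure.measurePreserving_swap.comp h1))))
  convert h5 using 1
  funext p v
  by_cases h : v = w₀
  · subst h
    rw [logCoord_w₀]
    simp only [Function.comp_apply, Prod.swap, Prod.map, id_eq,
      MeasurableEquiv.piEquivPiSubtypeProd, MeasurableEquiv.symm_mk, MeasurableEquiv.coe_mk,
      Equiv.piEquivPiSubtypeProd_symm_apply, dite_true, MeasurableEquiv.funUnique,
      Pi.add_apply, Finset.sum_add_distrib, Pi.smul_apply, smul_eq_mul, ← Finset.mul_sum]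
    have := sum_mult_div_finrank (F := F)
    change _ = p.1 - _
    linear_combination p.1 * this
  · have := logCoord_ne p.1 p.2 ⟨v, h⟩
    simp only at this
    rw [this]
    simp [Function.comp_apply, Prod.swap, Prod.map, id_eq,
      MeasurableEquiv.piEquivPiSubtypeProd, h, hc, mul_comm]

end LogCoordinates

/-! ### The measure dt/t in the logarithmic coordinate -/

section MulHaar

lemma measurePreserving_exp : MeasurePreserving Real.exp volume mulHaar := by
  refine ⟨Real.measurable_exp, ?_⟩
  ext A hA
  rw [Measure.map_apply Real.measurable_exp hA, mulHaar, withDensity_apply _ hA,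
    Measure.restrict_restrict hA]
  have h := lintegral_image_eq_lintegral_abs_deriv_mul MeasurableSet.univ
    (fun x _ => (Real.hasDerivAt_exp x).hasDerivWithinAt) Real.exp_injective.injOn
    (A.indicator fun t => ENNReal.ofReal t⁻¹)
  rw [Set.image_univ, Real.range_exp, setLIntegral_indicator hA, setLIntegral_univ] at h
  rw [h, ← lintegral_indicator_one (Real.measurable_exp hA)]
  refine lintegral_congr fun x => ?_
  by_cases hx : Real.exp x ∈ A
  · rw [Set.indicator_of_mem (by exact hx), Set.indicator_of_mem hx, abs_of_pos (Real.exp_pos x),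
      ← ENNReal.ofReal_mul (Real.exp_pos x).le, mul_inv_cancel₀ (Real.exp_pos x).ne',
      ENNReal.ofReal_one, Pi.one_apply]
  · rw [Set.indicator_of_notMem (by exact hx), Set.indicator_of_notMem hx, mul_zero]

instance : SigmaFinite mulHaar := by
  rw [mulHaar]
  exact SigmaFinite.withDensity_ofReal _

end MulHaar

/-! ### The gamma function as a Mellin transform -/

section GammaKernel

open Module NumberField.Units.dirichletUnitTheorem
open scoped Classical

variable {F : Type*} [Field F] [NumberField F]

/-- The function `exp (-∑_τ y_τ)` in logarithmic coordinates. -/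
def gammaKernel (u : InfinitePlace F → ℝ) : ℝ := Real.exp (-∑ τ : F →+* ℂ, embWeight u τ)

lemma gammaKernel_pos (u : InfinitePlace F → ℝ) : 0 < gammaKernel u := Real.exp_pos _

omit [NumberField F] in
lemma continuous_embWeight (τ : F →+* ℂ) : Continuous fun u => embWeight u τ := by
  unfold embWeight
  fun_prop

lemma continuous_gammaKernel : Continuous (gammaKernel : (InfinitePlace F → ℝ) → ℝ) :=
  Real.continuous_exp.comp (continuous_finsetSum _ fun τ _ => continuous_embWeight τ).neg

lemma posVector_exp (u : InfinitePlace F → ℝ) (τ : F →+* ℂ) :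
    posVector (fun v => Real.exp (u v)) τ = embWeight u τ := by
  rw [posVector, embWeight]
  split_ifs with h
  · rw [h.mult_eq_one, Nat.cast_one, div_one]
  · rw [(InfinitePlace.not_isReal_iff_isComplex.1 h).mult_eq_two, ← Real.exp_half]
    simp

lemma prod_embWeight_cpow (u : InfinitePlace F → ℝ) (s : ℂ) :
    ∏ τ : F →+* ℂ, ((embWeight u τ : ℝ) : ℂ) ^ s = Complex.exp (s * (∑ v, u v : ℝ)) := by
  have h : ∀ τ : F →+* ℂ, ((embWeight u τ : ℝ) : ℂ) ^ s =
      Complex.exp (s * (u (InfinitePlace.mk τ) / (InfinitePlace.mk τ).mult : ℝ)) := by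
    intro τ
    rw [embWeight, Complex.cpow_def_of_ne_zero (by exact_mod_cast (Real.exp_pos _).ne'),
      ← Complex.ofReal_log (Real.exp_pos _).le, Real.log_exp, mul_comm]
  rw [Finset.prod_congr rfl fun τ _ => h τ, ← Complex.exp_sum, ← Finset.mul_sum,
    ← Complex.ofReal_sum, sum_embeddings_comp_mk fun v => u v / v.mult]
  congr 3
  exact Finset.sum_congr rfl fun v _ => mul_div_cancel₀ _ InfinitePlace.mult_coe_ne_zero

/-- In the coordinates u = log t the measure dt/t is Lebesgue measure. The `mult` embeddings over a
place each contribute u/`mult` to the exponent, so the norm of y is exp of the plain sum of the u_v.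
-/
lemma higherGamma_eq_integral_exp (s : ℂ) :
    higherGamma F (fun _ => s) =
      ∫ u : InfinitePlace F → ℝ, (gammaKernel u : ℂ) * Complex.exp (s * (∑ v, u v : ℝ)) := by
  have hmp := measurePreserving_pi (fun _ : InfinitePlace F => (volume : Measure ℝ))
    (fun _ => mulHaar) (fun _ => measurePreserving_exp)
  have hemb : MeasurableEmbedding
      (fun (u : InfinitePlace F → ℝ) v => Real.exp (u v)) := by
    refine hmp.measurable.measurableEmbedding fun u u' h => funext fun v => ?_
    exact Real.exp_injective (congrFun h v)
  rw [higherGamma, ← hmp.integral_comp hemb]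
  refine integral_congr_ae (Eventually.of_forall fun u => ?_)
  simp only [posVector_exp]
  rw [Finset.prod_mul_distrib, prod_embWeight_cpow, gammaKernel, ← Complex.ofReal_prod,
    ← Real.exp_sum, Finset.sum_neg_distrib]

/-- This is Euler's integral for Γ(mσ) after the substitution y = m·exp(x/m), up to the constant
m^(mσ-1). -/
lemma integrable_exp_mul_exp_neg_exp {m σ : ℝ} (hm : 0 < m) (hσ : 0 < σ) :
    Integrable fun x : ℝ => Real.exp (σ * x) * Real.exp (-(m * Real.exp (x / m))) := by
  have h := Real.GammaIntegral_convergent (mul_pos hm hσ)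
  have hinj : Set.InjOn (fun x : ℝ => m * Real.exp (x / m)) Set.univ := by
    intro x _ y _ hxy
    have := Real.exp_injective (mul_left_cancel₀ hm.ne' hxy)
    exact (div_left_inj' hm.ne').1 this
  have himg : (fun x : ℝ => m * Real.exp (x / m)) '' Set.univ = Set.Ioi 0 := by
    ext y
    constructor
    · rintro ⟨x, -, rfl⟩
      exact mul_pos hm (Real.exp_pos _)
    · intro hy
      refine ⟨m * Real.log (y / m), trivial, ?_⟩
      simp only
      rw [mul_div_cancel_left₀ _ hm.ne', Real.exp_log (div_pos hy hm), mul_div_cancel₀ _ hm.ne']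
  have hder : ∀ x ∈ (Set.univ : Set ℝ), HasDerivWithinAt (fun x : ℝ => m * Real.exp (x / m))
      (Real.exp (x / m)) Set.univ x := by
    intro x _
    have := (((hasDerivAt_id x).div_const m).exp.const_mul m).hasDerivWithinAt (s := Set.univ)
    rwa [id_eq, mul_comm m, mul_assoc, one_div, inv_mul_cancel₀ hm.ne', mul_one] at this
  rw [← himg, integrableOn_image_iff_integrableOn_abs_deriv_smul MeasurableSet.univ hder hinj,
    integrableOn_univ] at h
  refine (h.const_mul (m ^ (m * σ - 1))⁻¹).congr (Eventually.of_forall fun x => ?_)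
  simp only [smul_eq_mul]
  have hne : m ^ (m * σ - 1) ≠ 0 := (Real.rpow_pos_of_pos hm _).ne'
  have hx : Real.exp (σ * x) =
      Real.exp (x / m) * Real.exp (x / m) ^ (m * σ - 1) := by
    rw [← Real.exp_mul, ← Real.exp_add]
    congr 1
    field_simp
    ring
  rw [abs_of_pos (Real.exp_pos _), Real.mul_rpow hm.le (Real.exp_pos _).le, hx]
  field_simp

lemma gammaKernel_mul_exp_eq_prod (u : InfinitePlace F → ℝ) (σ : ℝ) :
    gammaKernel u * Real.exp (σ * ∑ v, u v) =
      ∏ v : InfinitePlace F, Real.exp (σ * u v) * Real.exp (-(v.mult * Real.exp (u v / v.mult))) := by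
  simp only [gammaKernel, embWeight]
  rw [sum_embeddings_comp_mk fun v => Real.exp (u v / v.mult), Finset.prod_mul_distrib,
    ← Real.exp_sum, ← Real.exp_sum, Finset.mul_sum, Finset.sum_neg_distrib, mul_comm]

lemma integrable_gammaKernel_mul_exp {σ : ℝ} (hσ : 0 < σ) :
    Integrable fun u : InfinitePlace F → ℝ => gammaKernel u * Real.exp (σ * ∑ v, u v) := by
  simp only [gammaKernel_mul_exp_eq_prod]
  exact Integrable.fintype_prod (f := fun (v : InfinitePlace F) (x : ℝ) =>
    Real.exp (σ * x) * Real.exp (-(v.mult * Real.exp (x / v.mult)))) fun v =>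
      integrable_exp_mul_exp_neg_exp (by exact_mod_cast InfinitePlace.mult_pos) hσ

lemma integrable_gammaKernel_mul_cexp {s : ℂ} (hs : 0 < s.re) :
    Integrable fun u : InfinitePlace F → ℝ =>
      (gammaKernel u : ℂ) * Complex.exp (s * (∑ v, u v : ℝ)) := by
  refine (integrable_gammaKernel_mul_exp hs).mono' ?_ (Eventually.of_forall fun u => ?_)
  · refine Continuous.aestronglyMeasurable ?_
    exact (Complex.continuous_ofReal.comp continuous_gammaKernel).mul (by fun_prop)
  · rw [norm_mul, Complex.norm_real, Real.norm_of_nonneg (gammaKernel_pos u).le,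
      Complex.norm_exp, Complex.re_mul_ofReal]

/-- Positivity serves to divide by the Euler factor at real points, which is how convergence of the
Dirichlet series is obtained later. -/
lemma higherGamma_ofReal_pos {σ : ℝ} (hσ : 0 < σ) :
    0 < (higherGamma F (fun _ => (σ : ℂ))).re ∧ (higherGamma F (fun _ => (σ : ℂ))).im = 0 := by
  have h : higherGamma F (fun _ => (σ : ℂ)) =
      ((∫ u : InfinitePlace F → ℝ, gammaKernel u * Real.exp (σ * ∑ v, u v) : ℝ) : ℂ) := by
    rw [higherGamma_eq_integral_exp, ← integral_complex_ofReal]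
    refine integral_congr_ae (Eventually.of_forall fun u => ?_)
    push_cast
    rfl
  rw [h, Complex.ofReal_re, Complex.ofReal_im]
  refine ⟨?_, rfl⟩
  refine (integral_pos_iff_support_of_nonneg
    (fun u => (mul_pos (gammaKernel_pos u) (Real.exp_pos _)).le)
    (integrable_gammaKernel_mul_exp hσ)).2 ?_
  have : Function.support (fun u : InfinitePlace F → ℝ =>
      gammaKernel u * Real.exp (σ * ∑ v, u v)) = Set.univ :=
    Set.eq_univ_of_forall fun u => (mul_pos (gammaKernel_pos u) (Real.exp_pos _)).ne'
  rw [this]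
  exact isOpen_univ.measure_pos _ Set.univ_nonempty

variable (F) in
/-- The integral of `exp (-∑_τ y_τ)` over the positive vectors `y` of norm `t`. -/
def gammaRadial (t : ℝ) : ℝ := ∫ l : logSpace F, gammaKernel (logCoord (Real.log t) l)

lemma gammaRadial_nonneg (t : ℝ) : 0 ≤ gammaRadial F t :=
  integral_nonneg fun _ => (gammaKernel_pos _).le

lemma measurable_gammaRadial : Measurable (gammaRadial F) := by
  have hk : Measurable fun q : ℝ × logSpace F => gammaKernel (logCoord q.1 q.2) :=
    (continuous_gammaKernel.comp continuous_logCoord).measurable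
  have hm : Measurable fun p : ℝ × logSpace F => (Real.log p.1, p.2) :=
    (Real.measurable_log.comp measurable_fst).prodMk measurable_snd
  have h : StronglyMeasurable fun p : ℝ × logSpace F =>
      gammaKernel (logCoord (Real.log p.1) p.2) := (hk.comp hm).stronglyMeasurable
  exact h.integral_prod_right'.measurable

lemma mellin_eq_integral_exp (g : ℝ → ℂ) (s : ℂ) :
    mellin g s = ∫ a : ℝ, Complex.exp (s * a) * g (Real.exp a) := by
  have h := integral_image_eq_integral_abs_deriv_smul MeasurableSet.univ
    (fun x _ => (Real.hasDerivAt_exp x).hasDerivWithinAt) Real.exp_injective.injOn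
    (fun t : ℝ => (t : ℂ) ^ (s - 1) • g t)
  rw [Set.image_univ, Real.range_exp, Measure.restrict_univ] at h
  rw [mellin, h]
  refine integral_congr_ae (Eventually.of_forall fun x => ?_)
  simp only [smul_eq_mul, Complex.real_smul]
  rw [← mul_assoc, abs_of_pos (Real.exp_pos x)]
  congr 1
  have hne : ((Real.exp x : ℝ) : ℂ) ≠ 0 := by exact_mod_cast (Real.exp_pos x).ne'
  rw [Complex.cpow_def_of_ne_zero hne, ← Complex.ofReal_log (Real.exp_pos x).le, Real.log_exp,
    Complex.ofReal_exp, ← Complex.exp_add]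
  congr 1
  ring

/-- Fubini in the coordinates (a, l): exp(s ∑ u) depends on the norm coordinate a alone, so the
inner integral over the hyperplane is `gammaRadial`. -/
lemma mellin_gammaRadial {s : ℂ} (hs : 0 < s.re) :
    mellin (fun t => (gammaRadial F t : ℂ)) s = higherGamma F fun _ => s := by
  set G : (InfinitePlace F → ℝ) → ℂ :=
    fun u => (gammaKernel u : ℂ) * Complex.exp (s * (∑ v, u v : ℝ)) with hG
  have hint : Integrable G := integrable_gammaKernel_mul_cexp hs
  have hmp := measurePreserving_logCoord (F := F)
  have hint' : Integrable (fun p : ℝ × logSpace F => G (logCoord p.1 p.2))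
      (volume.prod volume) := (hmp.integrable_comp hint.aestronglyMeasurable).2 hint
  have h1 : ∫ u, G u = ∫ p : ℝ × logSpace F, G (logCoord p.1 p.2) ∂(volume.prod volume) := by
    have hG' : AEStronglyMeasurable G (Measure.map (fun p : ℝ × logSpace F => logCoord p.1 p.2)
        (volume.prod volume)) := by
      rw [hmp.map_eq]
      exact hint.aestronglyMeasurable
    rw [← integral_map hmp.measurable.aemeasurable hG', hmp.map_eq]
  rw [higherGamma_eq_integral_exp, h1, integral_prod _ hint', mellin_eq_integral_exp]
  refine integral_congr_ae (Eventually.of_forall fun a => ?_)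
  simp only [gammaRadial, Real.log_exp, hG, sum_logCoord]
  rw [integral_mul_const, integral_complex_ofReal, mul_comm]

end GammaKernel

/-! ### Elements of a fractional ideal, integral ideals of a class, and units -/

section IdealClassSums

open Module NumberField.Units.dirichletUnitTheorem FractionalIdeal
open scoped Classical

variable {F : Type*} [Field F] [NumberField F]

/-- The nonzero integral ideals in an ideal class. -/
abbrev ClassIdeal (c : ClassGroup (𝓞 F)) : Type _ :=
  {a : (Ideal (𝓞 F))⁰ // ClassGroup.mk0 a = c}

/-- The norm of an ideal, as a real number. -/
def ClassIdeal.norm {c : ClassGroup (𝓞 F)} (a : ClassIdeal c) : ℝ :=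
  (Ideal.absNorm ((a : (Ideal (𝓞 F))⁰) : Ideal (𝓞 F)) : ℕ)

lemma ClassIdeal.norm_pos {c : ClassGroup (𝓞 F)} (a : ClassIdeal c) : 0 < a.norm :=
  Nat.cast_pos.2 (Nat.pos_of_ne_zero (Ideal.absNorm_ne_zero_of_nonZeroDivisors a.1))

instance (c : ClassGroup (𝓞 F)) : Countable (ClassIdeal c) := by
  have h : (⋃ M : ℕ, {a : (Ideal (𝓞 F))⁰ | ClassGroup.mk0 a = c ∧
      Ideal.absNorm (a : Ideal (𝓞 F)) ≤ M}).Countable :=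
    Set.countable_iUnion fun M => (finite_ideals F c M).countable
  refine (h.mono fun a ha => ?_).to_subtype
  exact Set.mem_iUnion.2 ⟨_, ha, le_rfl⟩

/-- The classes c of a and c⁻¹ of J cancel, so aJ is principal. -/
lemma exists_generator (J : (FractionalIdeal (𝓞 F)⁰ F)ˣ) {c : ClassGroup (𝓞 F)}
    (hJ : ClassGroup.mk F J = c⁻¹) (a : ClassIdeal c) :
    ∃ x : F, x ≠ 0 ∧ spanSingleton (𝓞 F)⁰ x = (a.1 : Ideal (𝓞 F)) * J := by
  have h : ClassGroup.mk F (FractionalIdeal.mk0 F a.1 * J) = 1 := by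
    rw [map_mul, ClassGroup.mk_mk0, a.2, hJ, mul_inv_cancel]
  rw [ClassGroup.mk_eq_one_iff, FractionalIdeal.isPrincipal_iff] at h
  obtain ⟨x, hx⟩ := h
  refine ⟨x, ?_, ?_⟩
  · rintro rfl
    rw [spanSingleton_zero] at hx
    exact (FractionalIdeal.mk0 F a.1 * J).ne_zero hx
  · rw [← hx, Units.val_mul, FractionalIdeal.coe_mk0]

/-- The sum over the nonzero elements of a fractional ideal, arranged according to the integral
ideals that they generate. -/
lemma exists_tsum_eq_tsum_classIdeal (J : (FractionalIdeal (𝓞 F)⁰ F)ˣ) {c : ClassGroup (𝓞 F)}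
    (hJ : ClassGroup.mk F J = c⁻¹) :
    ∃ gen : ClassIdeal c → F, (∀ a, gen a ≠ 0) ∧
      (∀ a, |((Algebra.norm ℚ (gen a) : ℚ) : ℝ)| =
        a.norm * (absNorm (J : FractionalIdeal (𝓞 F)⁰ F) : ℝ)) ∧
      ∀ φ : F → ENNReal,
        ∑' x : {x : F // x ∈ (J : FractionalIdeal (𝓞 F)⁰ F) ∧ x ≠ 0}, φ x =
          ∑' a : ClassIdeal c, ∑' e : (𝓞 F)ˣ, φ (((e : 𝓞 F) : F) * gen a) := by
  choose gen hgen0 hgen using exists_generator J hJ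
  refine ⟨gen, hgen0, fun a => ?_, fun φ => ?_⟩
  · have h := congrArg absNorm (hgen a)
    rw [absNorm_span_singleton, map_mul, coeIdeal_absNorm] at h
    rw [ClassIdeal.norm]
    exact_mod_cast h
  have hunit : ∀ (e : (𝓞 F)ˣ) (x : F),
      spanSingleton (𝓞 F)⁰ (((e : 𝓞 F) : F) * x) = spanSingleton (𝓞 F)⁰ x := fun e x =>
    (spanSingleton_eq_spanSingleton.2 ⟨e, by rw [Units.smul_def, Algebra.smul_def]⟩).symm
  let f : ClassIdeal c × (𝓞 F)ˣ →
      {x : F // x ∈ (J : FractionalIdeal (𝓞 F)⁰ F) ∧ x ≠ 0} := fun p =>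
    ⟨((p.2 : 𝓞 F) : F) * gen p.1, by
      rw [← spanSingleton_le_iff_mem, hunit, hgen]
      calc ((p.1.1 : Ideal (𝓞 F)) : FractionalIdeal (𝓞 F)⁰ F) * J ≤ 1 * J :=
            mul_le_mul_left coeIdeal_le_one _
        _ = J := one_mul _,
      mul_ne_zero (by simp) (hgen0 p.1)⟩
  have hf : Function.Bijective f := by
    constructor
    · rintro ⟨a, e⟩ ⟨a', e'⟩ h
      have h1 : ((e : 𝓞 F) : F) * gen a = ((e' : 𝓞 F) : F) * gen a' := congrArg Subtype.val h
      have h2 := congrArg (spanSingleton (𝓞 F)⁰) h1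
      rw [hunit, hunit, hgen, hgen] at h2
      have h3 := coeIdeal_injective (K := F) (mul_right_cancel₀ J.ne_zero h2)
      obtain rfl : a = a' := Subtype.ext (Subtype.ext h3)
      have h4 := mul_right_cancel₀ (hgen0 a) h1
      rw [Prod.mk.injEq]
      exact ⟨rfl, Units.ext (RingOfIntegers.ext h4)⟩
    · rintro ⟨x, hxJ, hx0⟩
      -- The integral ideal belonging to x is (x)J⁻¹; it lies in c because J lies in c⁻¹.
      have hle : spanSingleton (𝓞 F)⁰ x * (J : FractionalIdeal (𝓞 F)⁰ F)⁻¹ ≤ 1 := by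
        rw [← mul_inv_cancel₀ J.ne_zero]
        exact mul_le_mul_left (spanSingleton_le_iff_mem.2 hxJ) _
      obtain ⟨a, ha⟩ := le_one_iff_exists_coeIdeal.1 hle
      have haJ : (a : FractionalIdeal (𝓞 F)⁰ F) * J = spanSingleton (𝓞 F)⁰ x := by
        rw [ha, mul_assoc, inv_mul_cancel₀ J.ne_zero, mul_one]
      have ha0 : a ≠ 0 := by
        rintro rfl
        have hzero : spanSingleton (𝓞 F)⁰ x = 0 := by
          rw [← haJ]
          simp
        exact hx0 (spanSingleton_eq_zero_iff.1 hzero)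
      have hmk : ClassGroup.mk0 ⟨a, mem_nonZeroDivisors_of_ne_zero ha0⟩ = c := by
        rw [← ClassGroup.mk_mk0 F, ← inv_inv c, ← hJ, ← map_inv, ← mul_inv_eq_one, ← map_inv,
          ← map_mul, inv_inv, ClassGroup.mk_eq_one_iff, FractionalIdeal.isPrincipal_iff]
        exact ⟨x, by rw [Units.val_mul, FractionalIdeal.coe_mk0, ← haJ]⟩
      have h5 := hgen ⟨⟨a, mem_nonZeroDivisors_of_ne_zero ha0⟩, hmk⟩
      rw [haJ, spanSingleton_eq_spanSingleton] at h5
      obtain ⟨e, he⟩ := h5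
      refine ⟨⟨⟨⟨a, mem_nonZeroDivisors_of_ne_zero ha0⟩, hmk⟩, e⟩, Subtype.ext ?_⟩
      change ((e : 𝓞 F) : F) * gen _ = x
      rw [← he, Units.smul_def, Algebra.smul_def]
  rw [← (Equiv.ofBijective f hf).tsum_eq, ENNReal.tsum_prod']
  rfl

/-- A sum over the units that depends only on the logarithms of the units. -/
lemma tsum_units_eq (φ : logSpace F → ENNReal) :
    ∑' e : (𝓞 F)ˣ, φ (Units.logEmbedding F (Additive.ofMul e)) =
      Units.torsionOrder F * ∑' l : Units.unitLattice F, φ l := by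
  have h1 : ∀ e : (𝓞 F)ˣ, Units.logEmbedding F (Additive.ofMul e) =
      (Units.logEmbeddingEquiv F (Additive.ofMul (QuotientGroup.mk e)) : logSpace F) := fun e =>
    (Units.logEmbeddingEquiv_apply F e).symm
  simp only [h1]
  -- Units are chosen representatives modulo torsion times roots of unity. The logarithm ignores the
  -- second factor, which therefore only contributes the count w.
  let g : ((𝓞 F)ˣ ⧸ Units.torsion F) × Units.torsion F → (𝓞 F)ˣ := fun p => p.1.out * p.2
  have hmk : ∀ p, (QuotientGroup.mk (g p) : (𝓞 F)ˣ ⧸ Units.torsion F) = p.1 := fun p => by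
    rw [QuotientGroup.mk_mul_of_mem _ p.2.2, QuotientGroup.out_eq']
  have hg : Function.Bijective g := by
    constructor
    · intro p p' h
      have h1 : p.1 = p'.1 := by rw [← hmk p, ← hmk p', h]
      refine Prod.ext h1 (Subtype.ext ?_)
      change p.1.out * (p.2 : (𝓞 F)ˣ) = p'.1.out * (p'.2 : (𝓞 F)ˣ) at h
      rw [h1] at h
      exact mul_left_cancel h
    · intro e
      refine ⟨(QuotientGroup.mk e, ⟨(QuotientGroup.mk e : (𝓞 F)ˣ ⧸ Units.torsion F).out⁻¹ * e,
        QuotientGroup.eq.1 (QuotientGroup.out_eq' _)⟩), ?_⟩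
      exact mul_inv_cancel_left _ _
  have := Fintype.ofFinite (Units.torsion F)
  rw [← (Equiv.ofBijective g hg).tsum_eq, ENNReal.tsum_prod', ENNReal.tsum_comm]
  simp only [Equiv.ofBijective_apply, hmk]
  rw [tsum_fintype, Finset.sum_const, Finset.card_univ, nsmul_eq_mul, Units.torsionOrder,
    Nat.card_eq_fintype_card]
  congr 1
  exact (Additive.ofMul.trans (Units.logEmbeddingEquiv F).toEquiv).tsum_eq
    fun l : Units.unitLattice F => φ l

end IdealClassSums

/-! ### Continuity and decay of theta series -/

section ThetaEstimates

open Module NumberField.Units.dirichletUnitTheorem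
open scoped Classical

variable {F : Type*} [Field F] [NumberField F]

lemma mul_embWeight_le {u u₀ : InfinitePlace F → ℝ} (h : ‖u - u₀‖ ≤ 1) (τ : F →+* ℂ) :
    Real.exp (-1) * embWeight u₀ τ ≤ embWeight u τ := by
  rw [embWeight, embWeight, ← Real.exp_add]
  refine Real.exp_le_exp.2 ?_
  set v := InfinitePlace.mk τ
  have hm : (1 : ℝ) ≤ v.mult := InfinitePlace.one_le_mult
  have h1 : |u v - u₀ v| ≤ 1 := (norm_le_pi_norm (u - u₀) v).trans h
  have h2 : u₀ v - u v ≤ v.mult := by linarith [(abs_le.1 h1).1]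
  have h3 : u₀ v / v.mult - u v / v.mult ≤ 1 := by
    rw [← sub_div]
    exact div_le_one_of_le₀ h2 (by linarith)
  linarith

lemma mul_embForm_le {u u₀ : InfinitePlace F → ℝ} {E : ℝ}
    (h : ∀ τ, E * embWeight u₀ τ ≤ embWeight u τ) (x : F) :
    E * embForm u₀ x ≤ embForm u x := by
  rw [embForm, embForm, Finset.mul_sum]
  refine Finset.sum_le_sum fun τ _ => ?_
  rw [← mul_assoc]
  exact mul_le_mul_of_nonneg_right (h τ) (sq_nonneg _)

lemma embForm_nonneg (u : InfinitePlace F → ℝ) (x : F) : 0 ≤ embForm u x :=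
  Finset.sum_nonneg fun τ _ => mul_nonneg (embWeight_pos u τ).le (sq_nonneg _)

lemma continuous_embForm (x : F) : Continuous fun u => embForm u x := by
  unfold embForm
  exact continuous_finsetSum _ fun τ _ => (continuous_embWeight τ).mul continuous_const

variable (J : (FractionalIdeal (𝓞 F)⁰ F)ˣ)

lemma summable_exp_neg_embForm (u : InfinitePlace F → ℝ) {t : ℝ} (ht : 0 < t) :
    Summable fun x : {x : F // x ∈ (J : FractionalIdeal (𝓞 F)⁰ F)} =>
      Real.exp (-t * embForm u (x : F)) := by
  have h : ∀ x, x ∈ (J : FractionalIdeal (𝓞 F)⁰ F) ↔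
      x ∈ Submodule.span ℤ (Set.range (basisOfFractionalIdeal F J)) :=
    fun x => (mem_span_basisOfFractionalIdeal F).symm
  rw [← (coordEquiv _ _ h).summable_iff]
  refine (summable_exp_neg_quadForm (posDef_embGram (basisOfFractionalIdeal F J) u) ht).congr
    fun m => ?_
  rw [Function.comp_apply, coe_coordEquiv, quadForm_embGram_intVec]

lemma exists_le_embForm : ∃ c : ℝ, 0 < c ∧ ∀ x : F, x ∈ (J : FractionalIdeal (𝓞 F)⁰ F) → x ≠ 0 →
    c ≤ embForm 0 x := by
  have h : ∀ x, x ∈ (J : FractionalIdeal (𝓞 F)⁰ F) ↔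
      x ∈ Submodule.span ℤ (Set.range (basisOfFractionalIdeal F J)) :=
    fun x => (mem_span_basisOfFractionalIdeal F).symm
  obtain ⟨c, hc, hq⟩ := exists_le_quadForm (posDef_embGram (basisOfFractionalIdeal F J) 0)
  refine ⟨c, hc, fun x hx hx0 => ?_⟩
  obtain ⟨m, hm⟩ := (coordEquiv _ _ h).surjective ⟨x, hx⟩
  have hm' : x = ∑ i, m i • basisOfFractionalIdeal F J i := by
    rw [← coe_coordEquiv _ _ h, hm]
  have hm0 : m ≠ 0 := by
    rintro rfl
    exact hx0 (by simpa using hm')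
  obtain ⟨i, hi⟩ := Function.ne_iff.1 hm0
  have h1 : (1 : ℝ) ≤ ∑ i, (intVec m i) ^ 2 := by
    refine le_trans ?_ (Finset.single_le_sum (f := fun i => intVec m i ^ 2)
      (fun i _ => sq_nonneg _) (Finset.mem_univ i))
    have : (1 : ℤ) ≤ m i ^ 2 := by
      have := sq_pos_of_ne_zero (show m i ≠ 0 from hi)
      omega
    exact_mod_cast this
  rw [hm', ← quadForm_embGram_intVec]
  exact le_trans (le_mul_of_one_le_right hc.le h1) (hq _)

lemma continuous_idealTheta : Continuous (idealTheta (J : FractionalIdeal (𝓞 F)⁰ F)) := by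
  rw [continuous_iff_continuousAt]
  intro u₀
  have hs := summable_exp_neg_embForm J u₀ (mul_pos Real.pi_pos (Real.exp_pos (-1)))
  have : ContinuousOn (idealTheta (J : FractionalIdeal (𝓞 F)⁰ F)) (Metric.ball u₀ 1) := by
    refine continuousOn_tsum (fun x => ?_) hs fun x u hu => ?_
    · exact (Real.continuous_exp.comp (continuous_const.mul (continuous_embForm _))).continuousOn
    · rw [Real.norm_of_nonneg (Real.exp_pos _).le]
      refine Real.exp_le_exp.2 ?_
      rw [Metric.mem_ball, dist_eq_norm] at hu
      have h1 := mul_embForm_le (mul_embWeight_le hu.le) (x : F)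
      have h2 := mul_le_mul_of_nonneg_left h1 Real.pi_pos.le
      linarith
  exact this.continuousAt (Metric.ball_mem_nhds u₀ one_pos)

/-- Splitting off the term of `0` from a theta series. -/
lemma hasSum_idealTheta_sub_one (u : InfinitePlace F → ℝ) :
    HasSum (fun x : {x : F // x ∈ (J : FractionalIdeal (𝓞 F)⁰ F) ∧ x ≠ 0} =>
      Real.exp (-Real.pi * embForm u (x : F)))
      (idealTheta (J : FractionalIdeal (𝓞 F)⁰ F) u - 1) := by
  have hs := (summable_exp_neg_embForm J u Real.pi_pos).hasSum
  set f : F → ℝ := fun x => Real.exp (-Real.pi * embForm u x) with hf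
  have h1 : HasSum (Set.indicator {x : F | x ∈ (J : FractionalIdeal (𝓞 F)⁰ F)} f)
      (idealTheta (J : FractionalIdeal (𝓞 F)⁰ F) u) := hasSum_subtype_iff_indicator.1 hs
  have h2 := h1.update 0 0
  have h0 : f 0 = 1 := by simp [hf, embForm]
  rw [Set.indicator_of_mem (show (0 : F) ∈ {x : F | x ∈ (J : FractionalIdeal (𝓞 F)⁰ F)} from
    FractionalIdeal.zero_mem _), h0] at h2
  have h3 : HasSum (Set.indicator {x : F | x ∈ (J : FractionalIdeal (𝓞 F)⁰ F) ∧ x ≠ 0} f)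
      (idealTheta (J : FractionalIdeal (𝓞 F)⁰ F) u - 1) := by
    have h4 : Set.indicator {x : F | x ∈ (J : FractionalIdeal (𝓞 F)⁰ F) ∧ x ≠ 0} f =
        Function.update (Set.indicator {x : F | x ∈ (J : FractionalIdeal (𝓞 F)⁰ F)} f) 0 0 := by
      funext x
      by_cases hx : x = 0
      · subst hx
        simp
      · rw [Function.update_of_ne hx]
        simp [Set.indicator, hx]
    rw [h4, show idealTheta (J : FractionalIdeal (𝓞 F)⁰ F) u - 1 =
      0 - 1 + idealTheta (J : FractionalIdeal (𝓞 F)⁰ F) u by ring]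
    exact h2
  exact hasSum_subtype_iff_indicator.2 h3

lemma one_le_idealTheta (u : InfinitePlace F → ℝ) :
    1 ≤ idealTheta (J : FractionalIdeal (𝓞 F)⁰ F) u := by
  have := (hasSum_idealTheta_sub_one J u).nonneg fun _ => (Real.exp_pos _).le
  linarith

/-- A theta series is exponentially close to `1` where all weights are large. -/
lemma exists_idealTheta_sub_one_le {e₀ : ℝ} (he₀ : 0 < e₀) :
    ∃ C k : ℝ, 0 < k ∧ ∀ E, e₀ ≤ E → ∀ u : InfinitePlace F → ℝ, (∀ τ, E ≤ embWeight u τ) →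
      idealTheta (J : FractionalIdeal (𝓞 F)⁰ F) u - 1 ≤ C * Real.exp (-k * E) := by
  obtain ⟨c, hc, hcJ⟩ := exists_le_embForm J
  have hS := summable_exp_neg_embForm J 0 (mul_pos Real.pi_pos (half_pos he₀))
  let i : {x : F // x ∈ (J : FractionalIdeal (𝓞 F)⁰ F) ∧ x ≠ 0} →
    {x : F // x ∈ (J : FractionalIdeal (𝓞 F)⁰ F)} := fun x => ⟨x, x.2.1⟩
  have hi : Function.Injective i := fun x y h => Subtype.ext (Subtype.mk.inj h)
  have hS' := hS.comp_injective hi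
  refine ⟨∑' x, Real.exp (-(Real.pi * (e₀ / 2)) * embForm 0 ((i x : F))), Real.pi * c / 2,
    by positivity, fun E hE u hu => ?_⟩
  rw [← tsum_mul_right]
  refine hasSum_le (fun x => ?_) (hasSum_idealTheta_sub_one J u) (hS'.mul_right _).hasSum
  rw [Function.comp_apply, ← Real.exp_add]
  refine Real.exp_le_exp.2 ?_
  have h1 : E * embForm 0 (x : F) ≤ embForm u (x : F) :=
    mul_embForm_le (fun τ => by simpa [embWeight] using hu τ) _
  have h2 := hcJ x x.2.1 x.2.2
  -- Half of the exponent, with E ≥ e₀, keeps the series summable uniformly in E; the other half,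
  -- with the form at least c, supplies the decay in E.
  have h3 : e₀ / 2 * embForm 0 (x : F) + c / 2 * E ≤ E * embForm 0 (x : F) := by
    have : 0 ≤ embForm 0 (x : F) := embForm_nonneg _ _
    nlinarith
  have h4 := mul_le_mul_of_nonneg_left (h3.trans h1) Real.pi_pos.le
  change -Real.pi * embForm u (x : F) ≤
    -(Real.pi * (e₀ / 2)) * embForm 0 (x : F) + -(Real.pi * c / 2) * E
  linarith

end ThetaEstimates

/-! ### A fundamental domain for the unit lattice -/

section UnitDomain

open Module NumberField.Units.dirichletUnitTheorem
open scoped Classical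

variable (F : Type*) [Field F] [NumberField F]

/-- A fundamental domain for the lattice of logarithms of units. -/
def unitDomain : Set (logSpace F) :=
  ZSpan.fundamentalDomain ((Units.basisUnitLattice F).ofZLatticeBasis ℝ (Units.unitLattice F))

lemma isAddFundamentalDomain_unitDomain :
    IsAddFundamentalDomain (Units.unitLattice F) (unitDomain F) volume :=
  ZLattice.isAddFundamentalDomain (Units.basisUnitLattice F) volume

lemma measurableSet_unitDomain : MeasurableSet (unitDomain F) :=
  ZSpan.fundamentalDomain_measurableSet _

lemma isBounded_unitDomain : Bornology.IsBounded (unitDomain F) :=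
  ZSpan.fundamentalDomain_isBounded _

lemma volume_unitDomain : (volume : Measure (logSpace F)).real (unitDomain F) = Units.regulator F :=
  (ZLattice.covolume_eq_measure_fundamentalDomain _ _
    (isAddFundamentalDomain_unitDomain F)).symm

lemma volume_unitDomain_lt_top : (volume : Measure (logSpace F)) (unitDomain F) < ⊤ :=
  (isBounded_unitDomain F).measure_lt_top

variable {F}

lemma logCoord_apply (a : ℝ) (l : logSpace F) (v : InfinitePlace F) :
    logCoord a l v = logCoord 0 l v + (v.mult : ℝ) / finrank ℚ F * a := by
  simp [logCoord]

/-- The domain is bounded, so its points change the weights only by bounded factors from exp(a/n),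
the value at l = 0. Thus all weights grow together with the norm. -/
lemma exists_le_embWeight : ∃ b : ℝ, 0 < b ∧ ∀ a : ℝ, ∀ l ∈ unitDomain F, ∀ τ : F →+* ℂ,
    b * Real.exp (a / finrank ℚ F) ≤ embWeight (logCoord a ((2 : ℝ) • l)) τ := by
  obtain ⟨R, hR⟩ := isBounded_iff_forall_norm_le.1 (isBounded_unitDomain F)
  have hcont : Continuous fun l : logSpace F => logCoord (0 : ℝ) ((2 : ℝ) • l) :=
    continuous_logCoord.comp (Continuous.prodMk continuous_const (continuous_const_smul _))
  obtain ⟨B, hB⟩ := (isCompact_closedBall (0 : logSpace F) R).exists_bound_of_continuousOn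
    hcont.continuousOn
  refine ⟨Real.exp (-B), Real.exp_pos _, fun a l hl τ => ?_⟩
  have h1 := hB l (by simpa using hR l hl)
  set v := InfinitePlace.mk τ with hv
  have h2 : |logCoord (0 : ℝ) ((2 : ℝ) • l) v| ≤ B := (norm_le_pi_norm _ v).trans h1
  have hm : (1 : ℝ) ≤ v.mult := InfinitePlace.one_le_mult
  rw [embWeight, ← hv, ← Real.exp_add, logCoord_apply]
  refine Real.exp_le_exp.2 ?_
  have h3 : -B ≤ logCoord (0 : ℝ) ((2 : ℝ) • l) v / v.mult := by
    rw [le_div_iff₀ (by linarith)]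
    have hB0 : 0 ≤ B := (abs_nonneg _).trans h2
    nlinarith [(abs_le.1 h2).1]
  have h4 : (v.mult : ℝ) / finrank ℚ F * a / v.mult = a / finrank ℚ F := by
    have : (v.mult : ℝ) ≠ 0 := by linarith
    field_simp
  rw [add_div, h4]
  linarith

end UnitDomain

/-! ### Unfolding the theta series over the units -/

section Unfolding

open Module NumberField.Units.dirichletUnitTheorem
open scoped Classical

variable {F : Type*} [Field F] [NumberField F]

/-- The logarithmic coordinates of the vector `π |x|²`. -/
def placeShift (x : F) (v : InfinitePlace F) : ℝ := v.mult * Real.log (Real.pi * v x ^ 2)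

/-- The factor 2 is there because a unit acts on the weights through |τe|². At `w₀`, which
`logSpace` omits, the product formula for units restores the coordinate. -/
lemma logCoord_logEmbedding (e : (𝓞 F)ˣ) (v : InfinitePlace F) :
    logCoord (0 : ℝ) ((2 : ℝ) • Units.logEmbedding F (Additive.ofMul e)) v =
      v.mult * (2 * Real.log (v (e : F))) := by
  by_cases h : v = w₀
  · subst h
    rw [logCoord_w₀]
    simp only [Pi.smul_apply, smul_eq_mul, ← Finset.mul_sum]
    rw [sum_logEmbedding_component]
    ring
  · have := logCoord_ne (0 : ℝ) ((2 : ℝ) • Units.logEmbedding F (Additive.ofMul e)) ⟨v, h⟩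
    simp only at this
    rw [this, Pi.smul_apply, logEmbedding_component, smul_eq_mul]
    ring

lemma placeShift_unit_mul (e : (𝓞 F)ˣ) {x : F} (hx : x ≠ 0) :
    placeShift (((e : 𝓞 F) : F) * x) =
      logCoord (0 : ℝ) ((2 : ℝ) • Units.logEmbedding F (Additive.ofMul e)) + placeShift x := by
  funext v
  have he : v ((e : 𝓞 F) : F) ≠ 0 := (v.pos_iff.2 (Units.coe_ne_zero e)).ne'
  have hv : v x ≠ 0 := (v.pos_iff.2 hx).ne'
  have hpi := Real.pi_ne_zero
  rw [Pi.add_apply, logCoord_logEmbedding, placeShift, placeShift, map_mul,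
    show Real.pi * (v ((e : 𝓞 F) : F) * v x) ^ 2 = v ((e : 𝓞 F) : F) ^ 2 * (Real.pi * v x ^ 2) by ring,
    Real.log_mul (pow_ne_zero 2 he) (mul_ne_zero hpi (pow_ne_zero 2 hv)), Real.log_pow]
  push_cast
  ring

lemma exp_sum_placeShift {x : F} (hx : x ≠ 0) :
    Real.exp (∑ v, placeShift x v) =
      Real.pi ^ finrank ℚ F * |((Algebra.norm ℚ x : ℚ) : ℝ)| ^ 2 := by
  have h : ∀ v : InfinitePlace F,
      Real.exp (placeShift x v) = Real.pi ^ v.mult * (v x ^ v.mult) ^ 2 := by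
    intro v
    have hv : 0 < v x := v.pos_iff.2 hx
    rw [placeShift, mul_comm, Real.exp_mul, Real.exp_log (by positivity), Real.rpow_natCast]
    ring
  rw [Real.exp_sum, Finset.prod_congr rfl fun v _ => h v, Finset.prod_mul_distrib,
    Finset.prod_pow_eq_pow_sum, InfinitePlace.sum_mult_eq, Finset.prod_pow,
    InfinitePlace.prod_eq_abs_norm, Rat.cast_abs]

/-- Absorbing π|τx|² into the weights turns each theta term into a translate of one fixed kernel,
which makes unfolding possible. -/
lemma gammaKernel_add_placeShift (u : InfinitePlace F → ℝ) {x : F} (hx : x ≠ 0) :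
    gammaKernel (u + placeShift x) = Real.exp (-Real.pi * embForm u x) := by
  rw [gammaKernel, embForm, neg_mul, Finset.mul_sum]
  congr 2
  refine Finset.sum_congr rfl fun τ _ => ?_
  have hτ : 0 < ‖τ x‖ := norm_pos_iff.2 ((map_ne_zero τ).2 hx)
  rw [embWeight, embWeight, Pi.add_apply, placeShift, add_div,
    mul_div_cancel_left₀ _ InfinitePlace.mult_coe_ne_zero, Real.exp_add, InfinitePlace.apply,
    Real.exp_log (by positivity)]
  ring

lemma lintegral_comp_two_smul (φ : logSpace F → ENNReal) :
    ∫⁻ l, φ ((2 : ℝ) • l) = ENNReal.ofReal ((2 ^ Units.rank F)⁻¹) * ∫⁻ l, φ l := by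
  have h := Measure.map_addHaar_smul (volume : Measure (logSpace F)) (two_ne_zero (α := ℝ))
  have he : MeasurableEmbedding fun l : logSpace F => (2 : ℝ) • l :=
    measurableEmbedding_const_smul₀ two_ne_zero
  rw [← he.lintegral_map, h, lintegral_smul_measure, Units.finrank_eq_rank,
    abs_of_pos (by positivity), smul_eq_mul]

/-- Translation invariance in the hyperplane removes every part of the shift except its total, that
is, the norm of x. The power of 2 is the Jacobian of doubling. -/
lemma lintegral_gammaKernel_add (a : ℝ) (s : InfinitePlace F → ℝ) :
    ∫⁻ l : logSpace F, ENNReal.ofReal (gammaKernel (logCoord a ((2 : ℝ) • l) + s)) =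
      ENNReal.ofReal ((2 ^ Units.rank F)⁻¹) *
        ∫⁻ l : logSpace F, ENNReal.ofReal (gammaKernel (logCoord (a + ∑ v, s v) l)) := by
  rw [lintegral_comp_two_smul fun l => ENNReal.ofReal (gammaKernel (logCoord a l + s)),
    ← lintegral_add_right_eq_self
      (fun l => ENNReal.ofReal (gammaKernel (logCoord (a + ∑ v, s v) l))) (logProj s)]
  simp only [logCoord_add, logCoord_logProj]

lemma continuous_logCoord_two_smul (a : ℝ) :
    Continuous fun l : logSpace F => logCoord a ((2 : ℝ) • l) :=
  continuous_logCoord.comp (Continuous.prodMk continuous_const (continuous_const_smul _))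

instance : VAddInvariantMeasure (Units.unitLattice F) (logSpace F) volume :=
  inferInstanceAs (VAddInvariantMeasure (Units.unitLattice F).toAddSubgroup (logSpace F) volume)

variable (J : (FractionalIdeal (𝓞 F)⁰ F)ˣ)

lemma integrableOn_unitDomain_idealTheta (a : ℝ) :
    IntegrableOn (fun l => idealTheta (J : FractionalIdeal (𝓞 F)⁰ F) (logCoord a ((2 : ℝ) • l)))
      (unitDomain F) := by
  have hc : Continuous fun l =>
      idealTheta (J : FractionalIdeal (𝓞 F)⁰ F) (logCoord a ((2 : ℝ) • l)) :=
    (continuous_idealTheta J).comp (continuous_logCoord_two_smul a)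
  exact (hc.continuousOn.integrableOn_compact (isBounded_unitDomain F).isCompact_closure).mono_set
    subset_closure

/-- Integrating the theta series of an ideal over a fundamental domain of the units, one finds a
series over the integral ideals of a class. -/
lemma hasSum_gammaRadial {c : ClassGroup (𝓞 F)} (hJ : ClassGroup.mk F J = c⁻¹) (a : ℝ) :
    HasSum (fun b : ClassIdeal c => (Units.torsionOrder F : ℝ) *
        gammaRadial F (Real.exp a * (Real.pi ^ finrank ℚ F *
          (b.norm * (FractionalIdeal.absNorm (J : FractionalIdeal (𝓞 F)⁰ F) : ℝ)) ^ 2)))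
      (2 ^ Units.rank F * ∫ l in unitDomain F,
        (idealTheta (J : FractionalIdeal (𝓞 F)⁰ F) (logCoord a ((2 : ℝ) • l)) - 1)) := by
  obtain ⟨gen, hgen0, hgenN, hgen⟩ := exists_tsum_eq_tsum_classIdeal J hJ
  set Θ : logSpace F → ℝ := fun l =>
    idealTheta (J : FractionalIdeal (𝓞 F)⁰ F) (logCoord a ((2 : ℝ) • l)) - 1 with hΘ
  have hΘ0 : ∀ l, 0 ≤ Θ l := fun l => sub_nonneg.2 (one_le_idealTheta J _)
  have hΘi : IntegrableOn Θ (unitDomain F) :=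
    (integrableOn_unitDomain_idealTheta J a).sub
      (integrableOn_const (volume_unitDomain_lt_top F).ne)
  let h : ClassIdeal c → logSpace F → ENNReal := fun b l =>
    ENNReal.ofReal (gammaKernel (logCoord a ((2 : ℝ) • l) + placeShift (gen b)))
  have hhm : ∀ b, Measurable (h b) := fun b => by
    refine ENNReal.measurable_ofReal.comp (Continuous.measurable ?_)
    exact continuous_gammaKernel.comp ((continuous_logCoord_two_smul a).add continuous_const)
  have hkm : ∀ b (k : Units.unitLattice F), Measurable fun l => h b (k +ᵥ l) := fun b k =>
    (hhm b).comp (measurable_const_vadd k)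
  have h1 : ∀ l, ENNReal.ofReal (Θ l) = ∑' b : ClassIdeal c,
      (Units.torsionOrder F : ENNReal) * ∑' k : Units.unitLattice F, h b (k +ᵥ l) := by
    intro l
    have hs := hasSum_idealTheta_sub_one J (logCoord a ((2 : ℝ) • l))
    rw [hΘ]
    simp only
    rw [← hs.tsum_eq, ENNReal.ofReal_tsum_of_nonneg (fun _ => (Real.exp_pos _).le) hs.summable]
    have h2 := hgen fun x =>
      ENNReal.ofReal (Real.exp (-Real.pi * embForm (logCoord a ((2 : ℝ) • l)) x))
    refine h2.trans (tsum_congr fun b => ?_)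
    refine (tsum_congr fun e => ?_).trans (tsum_units_eq fun m => h b (m + l))
    have he : ((e : 𝓞 F) : F) * gen b ≠ 0 := mul_ne_zero (Units.coe_ne_zero e) (hgen0 b)
    rw [← gammaKernel_add_placeShift _ he, placeShift_unit_mul e (hgen0 b), ← add_assoc,
      ← logCoord_add, add_zero, ← smul_add, add_comm l]
  have h2 : ∫⁻ l in unitDomain F, ENNReal.ofReal (Θ l) = ∑' b : ClassIdeal c,
      (Units.torsionOrder F : ENNReal) * ∫⁻ l, h b l := by
    rw [lintegral_congr h1, lintegral_tsum fun b => ?_]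
    · refine tsum_congr fun b => ?_
      rw [lintegral_const_mul _ (Measurable.tsum fun k => hkm b k),
        lintegral_tsum fun k => (hkm b k).aemeasurable,
        -- The unfolding: the lattice translates of the domain cover the whole hyperplane.
        (isAddFundamentalDomain_unitDomain F).lintegral_eq_tsum'' (h b)]
    · exact ((Measurable.tsum fun k => hkm b k).const_mul _).aemeasurable
  have h3 : ∀ b, ∫⁻ l, h b l = ENNReal.ofReal ((2 ^ Units.rank F)⁻¹) *
      ∫⁻ l : logSpace F, ENNReal.ofReal (gammaKernel (logCoord (Real.log (Real.exp a *
        (Real.pi ^ finrank ℚ F *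
          (b.norm * (FractionalIdeal.absNorm (J : FractionalIdeal (𝓞 F)⁰ F) : ℝ)) ^ 2))) l)) := by
    intro b
    rw [lintegral_gammaKernel_add, ← hgenN, ← exp_sum_placeShift (hgen0 b), ← Real.exp_add,
      Real.log_exp]
  -- Convergence is read off from the other side: a continuous theta series is integrable on a
  -- bounded domain.
  have h4 : ∑' b : ClassIdeal c, (Units.torsionOrder F : ENNReal) * ∫⁻ l, h b l ≠ ⊤ := by
    rw [← h2]
    exact hΘi.lintegral_lt_top.ne
  have h5 := (ENNReal.hasSum_toReal h4).mul_left (2 ^ Units.rank F)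
  have h6 : (∑' b : ClassIdeal c, ((Units.torsionOrder F : ENNReal) * ∫⁻ l, h b l).toReal) =
      ∫ l in unitDomain F, Θ l := by
    rw [integral_eq_lintegral_of_nonneg_ae (Eventually.of_forall hΘ0) hΘi.aestronglyMeasurable,
      h2, ENNReal.tsum_toReal_eq fun b => ?_]
    exact ENNReal.ne_top_of_tsum_ne_top h4 b
  rw [h6] at h5
  refine h5.congr_fun ?_
  intro b
  rw [h3, ENNReal.toReal_mul, ENNReal.toReal_mul, ENNReal.toReal_ofReal (by positivity),
    ENNReal.toReal_natCast, gammaRadial, integral_eq_lintegral_of_nonneg_ae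
      (Eventually.of_forall fun _ => (gammaKernel_pos _).le)]
  · field_simp
  · exact (continuous_gammaKernel.comp (continuous_logCoord.comp
      (Continuous.prodMk continuous_const continuous_id))).aestronglyMeasurable

end Unfolding

/-! ### Theta means and their functional equation -/

section ThetaMean

open Module NumberField.Units.dirichletUnitTheorem
open scoped Classical

variable {F : Type*} [Field F] [NumberField F]

lemma embForm_add_logCoord (u : InfinitePlace F → ℝ) (e : (𝓞 F)ˣ) (x : F) :
    embForm (u + logCoord (0 : ℝ) ((2 : ℝ) • Units.logEmbedding F (Additive.ofMul e))) x =
      embForm u (((e : 𝓞 F) : F) * x) := by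
  rw [embForm, embForm]
  refine Finset.sum_congr rfl fun τ _ => ?_
  have hτ : 0 < ‖τ ((e : 𝓞 F) : F)‖ := norm_pos_iff.2 ((map_ne_zero τ).2 (Units.coe_ne_zero e))
  rw [embWeight, embWeight, Pi.add_apply, logCoord_logEmbedding, add_div,
    mul_div_cancel_left₀ _ InfinitePlace.mult_coe_ne_zero, Real.exp_add, InfinitePlace.apply,
    mul_comm (2 : ℝ), Real.exp_mul, Real.exp_log hτ, Real.rpow_ofNat, map_mul, norm_mul]
  ring

omit [NumberField F] in
lemma unit_mul_mem_iff (J : FractionalIdeal (𝓞 F)⁰ F) (e : (𝓞 F)ˣ) (x : F) :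
    ((e : 𝓞 F) : F) * x ∈ J ↔ x ∈ J := by
  have h : ∀ (e : (𝓞 F)ˣ) (x : F), x ∈ J → ((e : 𝓞 F) : F) * x ∈ J := fun e x hx => by
    have := Submodule.smul_mem (J : Submodule (𝓞 F) F) (e : 𝓞 F) hx
    rwa [Algebra.smul_def] at this
  refine ⟨fun hx => ?_, h e x⟩
  have h1 := h e⁻¹ _ hx
  have h2 : (((e⁻¹ : (𝓞 F)ˣ) : 𝓞 F) : F) * ((e : 𝓞 F) : F) = 1 := by
    rw [← map_mul, Units.inv_mul, map_one]
  rwa [← mul_assoc, h2, one_mul] at h1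

/-- Multiplication by a unit as a permutation of a fractional ideal. -/
def unitMulEquiv (J : FractionalIdeal (𝓞 F)⁰ F) (e : (𝓞 F)ˣ) : {x : F // x ∈ J} ≃ {x : F // x ∈ J} :=
  (Equiv.mulLeft₀ ((e : 𝓞 F) : F) (Units.coe_ne_zero e)).subtypeEquiv
    fun x => (unit_mul_mem_iff J e x).symm

lemma idealTheta_add_logCoord (J : FractionalIdeal (𝓞 F)⁰ F) (u : InfinitePlace F → ℝ)
    (e : (𝓞 F)ˣ) :
    idealTheta J (u + logCoord (0 : ℝ) ((2 : ℝ) • Units.logEmbedding F (Additive.ofMul e))) =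
      idealTheta J u := by
  rw [idealTheta, idealTheta, ← (unitMulEquiv J e).tsum_eq
    fun x => Real.exp (-Real.pi * embForm u (x : F))]
  refine tsum_congr fun x => ?_
  rw [embForm_add_logCoord]
  rfl

lemma idealTheta_vadd (J : FractionalIdeal (𝓞 F)⁰ F) (a : ℝ) (k : Units.unitLattice F)
    (l : logSpace F) :
    idealTheta J (logCoord a ((2 : ℝ) • (k +ᵥ l))) = idealTheta J (logCoord a ((2 : ℝ) • l)) := by
  obtain ⟨k, e, -, rfl⟩ := k
  have h := idealTheta_add_logCoord J (logCoord a ((2 : ℝ) • l)) e.toMul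
  rw [← logCoord_add, add_zero, ← smul_add, add_comm] at h
  exact h

lemma isAddFundamentalDomain_neg_unitDomain :
    IsAddFundamentalDomain (Units.unitLattice F) (Neg.neg ⁻¹' unitDomain F) volume :=
  (isAddFundamentalDomain_unitDomain F).preimage_of_equiv
    (Measure.measurePreserving_neg volume).quasiMeasurePreserving (neg_involutive.bijective)
    fun k l => by
      change -(((-k : Units.unitLattice F) : logSpace F) + l) = (k : logSpace F) + -l
      rw [Submodule.coe_neg, neg_add, neg_neg]

/-- The reflected domain is again a fundamental domain, and a periodic function has the same
integral over each. -/
lemma setIntegral_unitDomain_neg {f : logSpace F → ℝ}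
    (hf : ∀ (k : Units.unitLattice F) l, f (k +ᵥ l) = f l) :
    ∫ l in unitDomain F, f (-l) = ∫ l in unitDomain F, f l := by
  rw [← isAddFundamentalDomain_neg_unitDomain.setIntegral_eq
      (isAddFundamentalDomain_unitDomain F) hf,
    ← (Measure.measurePreserving_neg (volume : Measure (logSpace F))).setIntegral_preimage_emb
      (MeasurableEquiv.neg (logSpace F)).measurableEmbedding]
  simp only [neg_neg]

/-- The mean of a theta series over the units, as a function of the norm. -/
def thetaMean (J : FractionalIdeal (𝓞 F)⁰ F) (T : ℝ) : ℝ :=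
  2 ^ Units.rank F * ∫ l in unitDomain F,
    idealTheta J (logCoord (Real.log T - Real.log (idealDisc J)) ((2 : ℝ) • l))

variable (J : (FractionalIdeal (𝓞 F)⁰ F)ˣ)

lemma absNorm_units_pos : (0 : ℝ) < (FractionalIdeal.absNorm (J : FractionalIdeal (𝓞 F)⁰ F) : ℝ) := by
  have h : FractionalIdeal.absNorm (J : FractionalIdeal (𝓞 F)⁰ F) ≠ 0 := by
    rw [Ne, FractionalIdeal.absNorm_eq_zero_iff]
    exact J.ne_zero
  exact_mod_cast lt_of_le_of_ne (FractionalIdeal.absNorm_nonneg _) h.symm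

lemma abs_discr_pos : (0 : ℝ) < |(discr F : ℝ)| := abs_pos.2 (by exact_mod_cast discr_ne_zero F)

lemma idealDisc_pos : 0 < idealDisc (J : FractionalIdeal (𝓞 F)⁰ F) :=
  mul_pos abs_discr_pos (pow_pos (absNorm_units_pos J) 2)

lemma thetaMean_sub (T : ℝ) :
    thetaMean (J : FractionalIdeal (𝓞 F)⁰ F) T - 2 ^ Units.rank F * Units.regulator F =
      2 ^ Units.rank F * ∫ l in unitDomain F, (idealTheta (J : FractionalIdeal (𝓞 F)⁰ F)
        (logCoord (Real.log T - Real.log (idealDisc (J : FractionalIdeal (𝓞 F)⁰ F)))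
          ((2 : ℝ) • l)) - 1) := by
  rw [integral_sub (integrableOn_unitDomain_idealTheta J _)
      (integrableOn_const (volume_unitDomain_lt_top F).ne), setIntegral_const,
    volume_unitDomain, smul_eq_mul, mul_one, mul_sub, thetaMean]

/-- The shift by the logarithm of `idealDisc J` cancels N(J)², so the series depends on J only
through its class. -/
lemma hasSum_thetaMean {c : ClassGroup (𝓞 F)} (hJ : ClassGroup.mk F J = c⁻¹) {T : ℝ} (hT : 0 < T) :
    HasSum (fun b : ClassIdeal c => (Units.torsionOrder F : ℝ) *
        gammaRadial F (Real.pi ^ finrank ℚ F * b.norm ^ 2 / |(discr F : ℝ)| * T))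
      (thetaMean (J : FractionalIdeal (𝓞 F)⁰ F) T - 2 ^ Units.rank F * Units.regulator F) := by
  rw [thetaMean_sub]
  refine (hasSum_gammaRadial J hJ _).congr_fun fun b => ?_
  have h1 := (absNorm_units_pos J).ne'
  have h2 := (abs_discr_pos (F := F)).ne'
  rw [Real.exp_sub, Real.exp_log hT, Real.exp_log (idealDisc_pos J), idealDisc]
  congr 2
  field_simp

/-- The dual of a fractional ideal for the trace form. -/
def idealDual : (FractionalIdeal (𝓞 F)⁰ F)ˣ :=
  Units.mk0 (FractionalIdeal.dual ℤ ℚ (J : FractionalIdeal (𝓞 F)⁰ F))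
    (FractionalIdeal.dual_ne_zero ℤ ℚ J.ne_zero)

lemma idealDual_eq : idealDual J = (FractionalIdeal.mk0 F ⟨differentIdeal ℤ (𝓞 F),
    mem_nonZeroDivisors_of_ne_zero differentIdeal_ne_bot⟩)⁻¹ * J⁻¹ := by
  refine Units.ext ?_
  rw [idealDual, Units.val_mk0, FractionalIdeal.dual_eq_mul_inv, Units.val_mul,
    Units.val_inv_eq_inv_val, Units.val_inv_eq_inv_val, FractionalIdeal.coe_mk0,
    coeIdeal_differentIdeal ℤ ℚ, inv_inv]

/-- Here the class of the different enters the functional equation: the dual of J is (𝔇J)⁻¹. -/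
lemma mk_idealDual {c c' : ClassGroup (𝓞 F)} (hJ : ClassGroup.mk F J = c⁻¹)
    (h : c * c' = differentClass F) : ClassGroup.mk F (idealDual J) = c'⁻¹ := by
  rw [idealDual_eq, map_mul, map_inv, map_inv, ClassGroup.mk_mk0, hJ, inv_inv]
  change (differentClass F)⁻¹ * c = c'⁻¹
  rw [← h, mul_inv, mul_comm c⁻¹, inv_mul_cancel_right]

lemma idealDisc_idealDual : idealDisc (idealDual J : FractionalIdeal (𝓞 F)⁰ F) =
    (idealDisc (J : FractionalIdeal (𝓞 F)⁰ F))⁻¹ := by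
  have h : ((FractionalIdeal.absNorm (idealDual J : FractionalIdeal (𝓞 F)⁰ F) : ℚ) : ℝ) =
      |(discr F : ℝ)|⁻¹ * (FractionalIdeal.absNorm (J : FractionalIdeal (𝓞 F)⁰ F) : ℝ)⁻¹ := by
    rw [idealDual_eq, Units.val_mul, map_mul, Units.val_inv_eq_inv_val, Units.val_inv_eq_inv_val,
      map_inv₀, map_inv₀, FractionalIdeal.coe_mk0, FractionalIdeal.coeIdeal_absNorm,
      absNorm_differentIdeal F]
    push_cast
    rw [Nat.cast_natAbs]
    push_cast
    rfl
  have h1 := (absNorm_units_pos J).ne'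
  have h2 := (abs_discr_pos (F := F)).ne'
  rw [idealDisc, idealDisc, h]
  field_simp

theorem thetaMean_one_div {T : ℝ} (hT : 0 < T) :
    thetaMean (J : FractionalIdeal (𝓞 F)⁰ F) (1 / T) =
      T ^ (1 / 2 : ℝ) * thetaMean (idealDual J : FractionalIdeal (𝓞 F)⁰ F) T := by
  have hd := idealDisc_pos J
  have h1 : ∀ l : logSpace F, idealTheta (J : FractionalIdeal (𝓞 F)⁰ F)
      (logCoord (Real.log (1 / T) - Real.log (idealDisc (J : FractionalIdeal (𝓞 F)⁰ F)))
        ((2 : ℝ) • l)) =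
      T ^ (1 / 2 : ℝ) * idealTheta (idealDual J : FractionalIdeal (𝓞 F)⁰ F)
        (logCoord (Real.log T - Real.log (idealDisc (idealDual J : FractionalIdeal (𝓞 F)⁰ F)))
          ((2 : ℝ) • -l)) := by
    intro l
    rw [idealTheta_inversion, sum_logCoord, ← logCoord_neg, Real.exp_sub, Real.exp_log hd,
      Real.exp_log (one_div_pos.2 hT), mul_div_cancel₀ _ hd.ne', idealDisc_idealDual, Real.log_inv,
      one_div, Real.log_inv, Real.inv_rpow hT.le, Real.rpow_neg hT.le, inv_inv, smul_neg]
    congr 3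
    ring_nf
  have h2 := setIntegral_unitDomain_neg (f := fun l =>
    idealTheta (idealDual J : FractionalIdeal (𝓞 F)⁰ F) (logCoord (Real.log T -
      Real.log (idealDisc (idealDual J : FractionalIdeal (𝓞 F)⁰ F))) ((2 : ℝ) • l)))
    fun k l => idealTheta_vadd _ _ k l
  rw [thetaMean, thetaMean, integral_congr_ae (Eventually.of_forall h1), integral_const_mul, h2]
  ring

lemma continuous_setIntegral_unitDomain {G : ℝ × logSpace F → ℝ} (hG : Continuous G) :
    Continuous fun a => ∫ l in unitDomain F, G (a, l) := by
  have hl : ∀ a, Continuous fun l => G (a, l) := fun a =>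
    hG.comp (continuous_const.prodMk continuous_id)
  have ha : ∀ l, Continuous fun a => G (a, l) := fun l =>
    hG.comp (continuous_id.prodMk continuous_const)
  rw [continuous_iff_continuousAt]
  intro a₀
  obtain ⟨C, hC⟩ := ((isCompact_closedBall a₀ 1).prod
    (isBounded_unitDomain F).isCompact_closure).exists_bound_of_continuousOn hG.continuousOn
  refine continuousAt_of_dominated (bound := fun _ => C) (Eventually.of_forall fun a =>
    (hl a).aestronglyMeasurable) ?_
    (integrableOn_const (volume_unitDomain_lt_top F).ne)
    (Eventually.of_forall fun l => (ha l).continuousAt)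
  filter_upwards [Metric.closedBall_mem_nhds a₀ one_pos] with a ha
  filter_upwards [ae_restrict_mem (measurableSet_unitDomain F)] with l hl
  exact hC (a, l) ⟨ha, subset_closure hl⟩

lemma continuousOn_thetaMean :
    ContinuousOn (thetaMean (J : FractionalIdeal (𝓞 F)⁰ F)) (Set.Ioi 0) := by
  have hlog : ContinuousOn (fun T =>
      Real.log T - Real.log (idealDisc (J : FractionalIdeal (𝓞 F)⁰ F))) (Set.Ioi 0) :=
    (Real.continuousOn_log.mono fun T hT => (ne_of_gt hT : T ≠ 0)).sub continuousOn_const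
  have hc : Continuous fun p : ℝ × logSpace F =>
      idealTheta (J : FractionalIdeal (𝓞 F)⁰ F) (logCoord p.1 ((2 : ℝ) • p.2)) :=
    (continuous_idealTheta J).comp
      (continuous_logCoord.comp (continuous_fst.prodMk (continuous_snd.const_smul (2 : ℝ))))
  have h := (continuous_setIntegral_unitDomain hc).comp_continuousOn hlog
  exact continuousOn_const.mul h

lemma isBigO_thetaMean (r : ℝ) :
    (fun T => thetaMean (J : FractionalIdeal (𝓞 F)⁰ F) T - 2 ^ Units.rank F * Units.regulator F)
      =O[atTop] fun T : ℝ => T ^ r := by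
  obtain ⟨b, hb, hbw⟩ := exists_le_embWeight (F := F)
  obtain ⟨C, k, hk, hCk⟩ := exists_idealTheta_sub_one_le J hb
  set d := idealDisc (J : FractionalIdeal (𝓞 F)⁰ F) with hd
  have hd0 : 0 < d := idealDisc_pos J
  set n : ℝ := ((finrank ℚ F : ℕ) : ℝ) with hn
  have hn0 : 0 < n := Nat.cast_pos.2 (finrank_pos (R := ℚ) (M := F))
  -- X = (T/d)^(1/n) is, up to the factor b, a lower bound for all weights on the domain; X ≥ 1 as
  -- soon as log T ≥ log d. Decay exponential in X beats X^(nr), which is a constant times T^r.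
  set X : ℝ → ℝ := fun T => Real.exp ((Real.log T - Real.log d) / n) with hX
  have hlog : Tendsto (fun T : ℝ => (Real.log T - Real.log d) / n) atTop atTop :=
    (tendsto_atTop_add_const_right _ _ Real.tendsto_log_atTop).atTop_div_const hn0
  have hXt : Tendsto X atTop atTop := Real.tendsto_exp_atTop.comp hlog
  have h1 : (fun T => thetaMean (J : FractionalIdeal (𝓞 F)⁰ F) T -
      2 ^ Units.rank F * Units.regulator F) =O[atTop] fun T => Real.exp (-(k * b) * X T) := by
    refine Asymptotics.IsBigO.of_bound (2 ^ Units.rank F * (C * Units.regulator F)) ?_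
    filter_upwards [hlog.eventually_ge_atTop 0] with T hT
    rw [thetaMean_sub, ← hd, norm_mul, Real.norm_of_nonneg (by positivity : (0:ℝ) ≤ 2 ^ _),
      Real.norm_of_nonneg (Real.exp_pos _).le, mul_assoc]
    refine mul_le_mul_of_nonneg_left ?_ (by positivity)
    have h2 := norm_setIntegral_le_of_norm_le_const (volume_unitDomain_lt_top F)
      (f := fun l => idealTheta (J : FractionalIdeal (𝓞 F)⁰ F)
        (logCoord (Real.log T - Real.log d) ((2 : ℝ) • l)) - 1)
      (C := C * Real.exp (-(k * b) * X T)) fun l hl => ?_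
    · rw [volume_unitDomain] at h2
      linarith
    · rw [Real.norm_of_nonneg (sub_nonneg.2 (one_le_idealTheta J _))]
      have h3 := hCk (b * X T) (le_mul_of_one_le_right hb.le (Real.one_le_exp hT)) _
        (hbw (Real.log T - Real.log d) l hl)
      rwa [← mul_assoc, neg_mul] at h3
  have h2 := ((isLittleO_exp_neg_mul_rpow_atTop (mul_pos hk hb) (n * r)).comp_tendsto hXt).isBigO
  refine (h1.trans h2).trans (Asymptotics.IsBigO.of_bound ‖(d ^ r)⁻¹‖ ?_)
  filter_upwards [eventually_gt_atTop 0] with T hT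
  rw [← norm_mul]
  refine le_of_eq (congrArg _ ?_)
  rw [Function.comp_apply, hX]
  simp only
  rw [← Real.exp_mul, show (Real.log T - Real.log d) / n * (n * r) =
    Real.log T * r + -(Real.log d * r) by field_simp; ring, Real.exp_add, Real.exp_neg,
    Real.exp_mul, Real.exp_mul, Real.exp_log hT, Real.exp_log hd0, mul_comm]

/-- The pair of a theta mean and that of the dual ideal, with its functional equation. -/
def thetaPair : WeakFEPair ℂ where
  f T := (thetaMean (J : FractionalIdeal (𝓞 F)⁰ F) T : ℂ)
  g T := (thetaMean (idealDual J : FractionalIdeal (𝓞 F)⁰ F) T : ℂ)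
  k := 1 / 2
  ε := 1
  f₀ := ((2 ^ Units.rank F * Units.regulator F : ℝ) : ℂ)
  g₀ := ((2 ^ Units.rank F * Units.regulator F : ℝ) : ℂ)
  hf_int := (Complex.continuous_ofReal.comp_continuousOn
    (continuousOn_thetaMean J)).locallyIntegrableOn measurableSet_Ioi
  hg_int := (Complex.continuous_ofReal.comp_continuousOn
    (continuousOn_thetaMean (idealDual J))).locallyIntegrableOn measurableSet_Ioi
  hk := by norm_num
  hε := one_ne_zero
  h_feq T hT := by
    rw [thetaMean_one_div J hT, one_mul, smul_eq_mul, Complex.ofReal_mul]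
  hf_top r := by
    simp only [← Complex.ofReal_sub]
    exact (Complex.isBigO_ofReal_left).2 (isBigO_thetaMean J r)
  hg_top r := by
    simp only [← Complex.ofReal_sub]
    exact (Complex.isBigO_ofReal_left).2 (isBigO_thetaMean (idealDual J) r)

end ThetaMean

/-! ### Completed partial zeta functions of a number field -/

section CompletedZeta

open Module NumberField.Units.dirichletUnitTheorem
open scoped Classical

/-- Needed because the means of two ideals in one class are compared through their series, hence at
positive T only. The function `g` matters only through its constant `g₀`. -/
lemma weakFEPair_Λ_congr {P Q : WeakFEPair ℂ} (hf : Set.EqOn P.f Q.f (Set.Ioi 0))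
    (hk : P.k = Q.k) (hε : P.ε = Q.ε) (hf₀ : P.f₀ = Q.f₀) (hg₀ : P.g₀ = Q.g₀) : P.Λ = Q.Λ := by
  have h : P.f_modif = Q.f_modif := by
    rw [WeakFEPair.f_modif, WeakFEPair.f_modif, hk, hε, hf₀, hg₀]
    congr 1
    · refine Set.indicator_congr fun x hx => ?_
      rw [hf (Set.mem_Ioi.2 (lt_trans one_pos (Set.mem_Ioi.1 hx)))]
    · refine Set.indicator_congr fun x hx => ?_
      rw [hf (show x ∈ Set.Ioi (0 : ℝ) from hx.1)]
  funext s
  rw [WeakFEPair.Λ, WeakFEPair.Λ, WeakFEPair.Λ₀, WeakFEPair.Λ₀, h, hk, hε, hf₀, hg₀]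

variable {F : Type*} [Field F] [NumberField F]

section Dirichlet

variable (J : (FractionalIdeal (𝓞 F)⁰ F)ˣ) {c : ClassGroup (𝓞 F)}

lemma hasSum_thetaPair_Λ (hJ : ClassGroup.mk F J = c⁻¹) {s : ℂ} (hs : 1 / 2 < s.re) :
    HasSum (fun b : ClassIdeal c => (Units.torsionOrder F : ℂ) *
      (((Real.pi ^ finrank ℚ F * b.norm ^ 2 / |(discr F : ℝ)| : ℝ) : ℂ) ^ (-s) *
        higherGamma F fun _ => s)) ((thetaPair J).Λ s) := by
  have hs0 : 0 < s.re := lt_trans (by norm_num) hs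
  obtain ⟨hconv, hval⟩ := (thetaPair J).hasMellin (s := s) hs
  set q : ClassIdeal c → ℝ := fun b => Real.pi ^ finrank ℚ F * b.norm ^ 2 / |(discr F : ℝ)| with hq
  have hq0 : ∀ b, 0 < q b := fun b =>
    div_pos (mul_pos (pow_pos Real.pi_pos _) (pow_pos b.norm_pos 2)) abs_discr_pos
  set f : ℝ → ℝ := fun t =>
    thetaMean (J : FractionalIdeal (𝓞 F)⁰ F) t - 2 ^ Units.rank F * Units.regulator F with hf
  have hfs : ∀ t, 0 < t → HasSum (fun b => (Units.torsionOrder F : ℝ) * gammaRadial F (q b * t))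
      (f t) := fun t ht => hasSum_thetaMean J hJ ht
  have hff : ∀ t, (thetaPair J).f t - (thetaPair J).f₀ = (f t : ℂ) := fun t => by
    simp [thetaPair, hf]
  simp only [hff] at hconv hval
  have hterm : ∀ b, ∫ t : ℝ in Set.Ioi 0, (t : ℂ) ^ (s - 1) •
      (((Units.torsionOrder F : ℝ) * gammaRadial F (q b * t) : ℝ) : ℂ) =
      (Units.torsionOrder F : ℂ) * (((q b : ℝ) : ℂ) ^ (-s) * higherGamma F fun _ => s) := by
    intro b
    rw [← mellin_gammaRadial hs0, ← smul_eq_mul (((q b : ℝ) : ℂ) ^ (-s)),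
      ← mellin_comp_mul_left _ _ (hq0 b), mellin, ← integral_const_mul]
    refine integral_congr_ae (Eventually.of_forall fun t => ?_)
    simp only [smul_eq_mul]
    push_cast
    ring
  rw [← hval, mellin]
  refine HasSum.congr_fun ?_ fun b => (hterm b).symm
  have hnorm : ∀ {t : ℝ}, 0 < t → ∀ {y : ℝ}, 0 ≤ y →
      ‖(t : ℂ) ^ (s - 1) • (y : ℂ)‖ = t ^ (s.re - 1) * y := fun {t} ht {y} hy => by
    rw [norm_smul, Complex.norm_cpow_eq_rpow_re_of_pos ht, Complex.norm_real,
      Real.norm_of_nonneg hy]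
    simp
  have hy0 : ∀ b t, 0 ≤ (Units.torsionOrder F : ℝ) * gammaRadial F (q b * t) := fun b t =>
    mul_nonneg (Nat.cast_nonneg _) (gammaRadial_nonneg _)
  -- The terms of the theta mean are nonnegative, so the sum of their norms is the norm of the full
  -- integrand, whose integrability comes with the Mellin transform of the pair.
  refine hasSum_integral_of_dominated_convergence (fun b t => t ^ (s.re - 1) *
    ((Units.torsionOrder F : ℝ) * gammaRadial F (q b * t))) (fun b => ?_) (fun b => ?_) ?_ ?_ ?_
  · refine Measurable.aestronglyMeasurable ?_
    have h1 : Measurable fun t : ℝ => gammaRadial F (q b * t) :=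
      measurable_gammaRadial.comp (measurable_const_mul (q b))
    have h2 : Measurable fun t : ℝ => (t : ℂ) ^ (s - 1) := by fun_prop
    exact h2.smul (Complex.measurable_ofReal.comp (h1.const_mul _))
  · filter_upwards [ae_restrict_mem measurableSet_Ioi] with t ht
    exact (hnorm ht (hy0 b t)).le
  · filter_upwards [ae_restrict_mem measurableSet_Ioi] with t ht
    exact (hfs t ht).summable.mul_left _
  · refine Integrable.congr (Integrable.norm hconv) ?_
    filter_upwards [ae_restrict_mem measurableSet_Ioi] with t ht
    rw [hnorm ht ((hfs t ht).nonneg fun b => hy0 b t), tsum_mul_left, (hfs t ht).tsum_eq]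
  · filter_upwards [ae_restrict_mem measurableSet_Ioi] with t ht
    exact (Complex.hasSum_ofReal.2 (hfs t ht)).const_smul _

end Dirichlet

/-- A fractional ideal in the inverse of an ideal class. -/
def classRep (c : ClassGroup (𝓞 F)) : (FractionalIdeal (𝓞 F)⁰ F)ˣ :=
  FractionalIdeal.mk0 F (ClassGroup.mk0_surjective c⁻¹).choose

lemma mk_classRep (c : ClassGroup (𝓞 F)) : ClassGroup.mk F (classRep c) = c⁻¹ := by
  rw [classRep, ClassGroup.mk_mk0]
  exact (ClassGroup.mk0_surjective c⁻¹).choose_spec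

variable (c : ClassGroup (𝓞 F))

/-- The completed partial zeta function of an ideal class. -/
def completedZeta (s : ℂ) : ℂ :=
  (Units.torsionOrder F : ℂ)⁻¹ * (thetaPair (classRep c)).Λ (s / 2)

/-- The entire part of the completed partial zeta function of an ideal class. -/
def completedZeta₀ (s : ℂ) : ℂ :=
  (Units.torsionOrder F : ℂ)⁻¹ * (thetaPair (classRep c)).Λ₀ (s / 2)

lemma torsionOrder_ne_zero : (Units.torsionOrder F : ℂ) ≠ 0 :=
  Nat.cast_ne_zero.2 (Units.torsionOrder_ne_zero F)

/-- The unit rank is r - 1; the separate factor 2 is the one produced by the poles in the variable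
s/2. -/
lemma residueConst_eq : residueConst F = (Units.torsionOrder F : ℂ)⁻¹ *
    (2 * (2 ^ Units.rank F * Units.regulator F)) := by
  have h : Fintype.card (InfinitePlace F) = Units.rank F + 1 := by
    have : 0 < Fintype.card (InfinitePlace F) := Fintype.card_pos
    rw [Units.rank]
    omega
  rw [residueConst, h]
  ring

lemma residueConst_ne_zero : residueConst F ≠ 0 := by
  have h := Units.regulator_ne_zero F
  rw [residueConst]
  exact div_ne_zero (mul_ne_zero (by simp) (Complex.ofReal_ne_zero.2 h)) torsionOrder_ne_zero

lemma completedZeta_eq (s : ℂ) :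
    completedZeta c s = completedZeta₀ c s - residueConst F / s - residueConst F / (1 - s) := by
  have h1 : (1 : ℂ) / (s / 2) = 2 / s := by rw [one_div_div]
  have h2 : (1 : ℂ) / (((1 / 2 : ℝ) : ℂ) - s / 2) = 2 / (1 - s) := by
    push_cast
    rw [← sub_div, one_div_div]
  rw [completedZeta, completedZeta₀, WeakFEPair.Λ, residueConst_eq]
  simp only [thetaPair, smul_eq_mul, h1, h2]
  push_cast
  ring

lemma differentiable_completedZeta₀ : Differentiable ℂ (completedZeta₀ c) :=
  ((thetaPair (classRep c)).differentiable_Λ₀.comp (differentiable_id.div_const 2)).const_mul _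

lemma differentiableOn_completedZeta : DifferentiableOn ℂ (completedZeta c) {0, 1}ᶜ := by
  intro s hs
  have h0 : s ≠ 0 := fun h => hs (by simp [h])
  have h1 : 1 - s ≠ 0 := fun h => hs (by simp [(sub_eq_zero.1 h).symm])
  rw [funext (completedZeta_eq c)]
  exact (((differentiable_completedZeta₀ c s).sub ((differentiableAt_const _).div
    differentiableAt_id h0)).sub ((differentiableAt_const _).div
    ((differentiableAt_const _).sub differentiableAt_id) h1)).differentiableWithinAt

/-- The numerator of the completed partial zeta function at its pole `0`. -/
def zetaNumerator₀ (s : ℂ) : ℂ :=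
  s * completedZeta₀ c s - residueConst F - residueConst F * s / (1 - s)

/-- The numerator of the completed partial zeta function at its pole `1`. -/
def zetaNumerator₁ (s : ℂ) : ℂ :=
  (s - 1) * completedZeta₀ c s - residueConst F * (s - 1) / s + residueConst F

lemma zetaNumerator₀_zero : zetaNumerator₀ c 0 = -residueConst F := by simp [zetaNumerator₀]

lemma zetaNumerator₁_one : zetaNumerator₁ c 1 = residueConst F := by simp [zetaNumerator₁]

lemma completedZeta_eq_div {s : ℂ} (hs : s ≠ 0) : completedZeta c s = zetaNumerator₀ c s / s := by
  rw [completedZeta_eq, zetaNumerator₀]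
  field_simp

lemma completedZeta_eq_div_sub_one {s : ℂ} (hs : s ≠ 1) :
    completedZeta c s = zetaNumerator₁ c s / (s - 1) := by
  have h : s - 1 ≠ 0 := sub_ne_zero.2 hs
  rw [completedZeta_eq, zetaNumerator₁, ← neg_sub s 1, div_neg, add_div, sub_div,
    mul_div_cancel_left₀ _ h, mul_div_right_comm, mul_div_cancel_right₀ _ h]
  ring

lemma differentiableOn_zetaNumerator₀ :
    DifferentiableOn ℂ (zetaNumerator₀ c) (Metric.ball 0 1) := by
  intro s hs
  have h1 : 1 - s ≠ 0 := fun h => by simp [(sub_eq_zero.1 h).symm] at hs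
  exact (((differentiableAt_id.mul (differentiable_completedZeta₀ c s)).sub
    (differentiableAt_const _)).sub (((differentiableAt_const _).mul differentiableAt_id).div
    ((differentiableAt_const _).sub differentiableAt_id) h1)).differentiableWithinAt

lemma differentiableOn_zetaNumerator₁ :
    DifferentiableOn ℂ (zetaNumerator₁ c) (Metric.ball 1 1) := by
  intro s hs
  have h0 : s ≠ 0 := fun h => by simp [h] at hs
  exact ((((differentiableAt_id.sub (differentiableAt_const _)).mul
    (differentiable_completedZeta₀ c s)).sub (((differentiableAt_const _).mul
    (differentiableAt_id.sub (differentiableAt_const _))).div differentiableAt_id h0)).add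
    (differentiableAt_const _)).differentiableWithinAt

/-- The **functional equation** of partial zeta functions. -/
theorem completedZeta_one_sub {c c' : ClassGroup (𝓞 F)} (h : c * c' = differentClass F) (s : ℂ) :
    completedZeta c (1 - s) = completedZeta c' s := by
  have h1 : (thetaPair (classRep c)).symm.Λ = (thetaPair (classRep c')).Λ := by
    refine weakFEPair_Λ_congr (fun T hT => ?_) rfl inv_one rfl rfl
    -- The dual of the representative of c need not be the chosen representative of c', but both
    -- means have the same series.
    have h2 := hasSum_thetaMean (idealDual (classRep c)) (mk_idealDual _ (mk_classRep c) h) hT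
    have h3 := hasSum_thetaMean (classRep c') (mk_classRep c') hT
    have h4 := sub_left_injective (h2.unique h3)
    exact congrArg Complex.ofReal h4
  rw [completedZeta, completedZeta, ← h1]
  have h5 := (thetaPair (classRep c)).functional_equation (s / 2)
  rw [show (thetaPair (classRep c)).ε = 1 from rfl, one_smul,
    show (((thetaPair (classRep c)).k : ℝ) : ℂ) - s / 2 = (1 - s) / 2 by
      simp only [thetaPair]; push_cast; ring] at h5
  rw [h5]

lemma eulerFactorInfty_mul (s : ℂ) {x : ℝ} (hx : 0 < x) :
    ((Real.pi ^ finrank ℚ F * x ^ 2 / |(discr F : ℝ)| : ℝ) : ℂ) ^ (-(s / 2)) *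
      higherGamma F (fun _ => s / 2) = eulerFactorInfty F s * (1 / (x : ℂ) ^ s) := by
  have hd := abs_discr_pos (F := F)
  have hpi := Real.pi_pos
  have hd' : (((|discr F| : ℤ)) : ℂ) = ((|(discr F : ℝ)| : ℝ) : ℂ) := by
    rw [← Int.cast_abs, Complex.ofReal_intCast]
  have hcpow : ∀ {y : ℝ}, 0 < y → ∀ z : ℂ, (y : ℂ) ^ z = Complex.exp (Real.log y * z) :=
    fun {y} hy z => by
      rw [Complex.cpow_def_of_ne_zero (Complex.ofReal_ne_zero.2 hy.ne'),
        Complex.ofReal_log hy.le]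
  rw [eulerFactorInfty, hd', hcpow (by positivity), hcpow hd, hcpow hpi, hcpow hx, one_div,
    ← Complex.exp_neg, ← Complex.exp_add, mul_right_comm, ← Complex.exp_add,
    Real.log_div (by positivity) hd.ne', Real.log_mul (by positivity) (by positivity),
    Real.log_pow, Real.log_pow]
  congr 2
  push_cast
  ring

lemma hasSum_completedZeta {s : ℂ} (hs : 1 < s.re) :
    HasSum (fun b : ClassIdeal c => eulerFactorInfty F s * (1 / (b.norm : ℂ) ^ s))
      (completedZeta c s) := by
  have hs2 : 1 / 2 < (s / 2).re := by
    rw [show s / 2 = s / (2 : ℝ) by norm_num, Complex.div_ofReal_re]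
    linarith
  refine ((hasSum_thetaPair_Λ (classRep c) (mk_classRep c) hs2).mul_left
    (Units.torsionOrder F : ℂ)⁻¹).congr_fun fun b => ?_
  rw [inv_mul_cancel_left₀ torsionOrder_ne_zero, eulerFactorInfty_mul s b.norm_pos]

lemma eulerFactorInfty_ofReal_ne_zero {σ : ℝ} (hσ : 0 < σ) : eulerFactorInfty F (σ : ℂ) ≠ 0 := by
  have h := (higherGamma_ofReal_pos (F := F) (half_pos hσ)).1
  rw [eulerFactorInfty]
  refine mul_ne_zero (mul_ne_zero ?_ ?_) ?_
  · exact fun h => by simp [Complex.cpow_eq_zero_iff, discr_ne_zero] at h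
  · exact fun h => by simp [Complex.cpow_eq_zero_iff, Real.pi_ne_zero] at h
  · intro h0
    rw [show (σ : ℂ) / 2 = ((σ / 2 : ℝ) : ℂ) by push_cast; rfl] at h0
    rw [h0] at h
    simp at h

/-- The absolute values depend only on Re s, so one may sum at that real point, where the Euler
factor is nonzero and can be cancelled from the completed series. -/
lemma summable_one_div_norm_cpow {s : ℂ} (hs : 1 < s.re) :
    Summable fun b : ClassIdeal c => 1 / (b.norm : ℂ) ^ s := by
  have h1 : (1 : ℝ) < ((s.re : ℝ) : ℂ).re := hs
  have h2 := (summable_mul_left_iff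
    (eulerFactorInfty_ofReal_ne_zero (F := F) (by linarith : 0 < s.re))).1
    (hasSum_completedZeta c h1).summable
  refine Summable.of_norm (h2.norm.congr fun b => ?_)
  rw [norm_div, norm_div, Complex.norm_cpow_eq_rpow_re_of_pos b.norm_pos,
    Complex.norm_cpow_eq_rpow_re_of_pos b.norm_pos, Complex.ofReal_re]

theorem exists_tendsto_zetaPartialSum {s : ℂ} (hs : 1 < s.re) :
    ∃ σ, Tendsto (fun M => zetaPartialSum F c M s) atTop (nhds σ) ∧
      completedZeta c s = eulerFactorInfty F s * σ := by
  have hsum := summable_one_div_norm_cpow c hs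
  refine ⟨_, ?_, (hasSum_completedZeta c hs).unique (hsum.hasSum.mul_left _)⟩
  have ht : Tendsto (fun M : ℕ => (finite_ideals F c M).toFinset.subtype
      fun a => ClassGroup.mk0 a = c) atTop atTop := by
    refine tendsto_atTop_finset_of_monotone (fun M N hMN => ?_) fun b =>
      ⟨Ideal.absNorm (b.1 : Ideal (𝓞 F)), ?_⟩
    · intro b hb
      simp only [Finset.mem_subtype, Set.Finite.mem_toFinset, Set.mem_ofPred_eq] at hb ⊢
      exact ⟨hb.1, hb.2.trans hMN⟩
    · simp only [Finset.mem_subtype, Set.Finite.mem_toFinset, Set.mem_ofPred_eq]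
      exact ⟨b.2, le_rfl⟩
  refine (hsum.hasSum.comp ht).congr fun M => ?_
  rw [Function.comp_apply, zetaPartialSum, ← Finset.sum_subtype_of_mem (p := fun a =>
    ClassGroup.mk0 a = c) _ fun a ha => ((Set.Finite.mem_toFinset _).1 ha).1]
  refine Finset.sum_congr rfl fun b _ => ?_
  simp only [ClassIdeal.norm, Complex.ofReal_natCast]

end CompletedZeta

/-! ### Transfer to the ultrapower -/

section Transfer

variable {ι : Type*} {U : Ultrafilter ι}

lemma hyper_coe_ne {α : Type*} {x y : ι → α} (h : (x : Hyper U α) ≠ (y : Hyper U α)) :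
    ∀ᶠ i in U, x i ≠ y i :=
  Ultrafilter.eventually_not.2 fun h' => h (Germ.coe_eq.2 h')

lemma exists_delta_of_hasDerivAt {f : ℂ → ℂ} {f' z : ℂ} (h : HasDerivAt f f' z) {ε : ℝ}
    (hε : 0 < ε) : ∃ δ : ℝ, 0 < δ ∧ ∀ w : ℂ, w ≠ 0 → ‖w‖ < δ →
      ‖(f (z + w) - f z) / w - f'‖ < ε := by
  obtain ⟨δ, hδ, hw⟩ := Metric.tendsto_nhdsWithin_nhds.1 h.tendsto_slope_zero ε hε
  refine ⟨δ, hδ, fun w hw0 hwδ => ?_⟩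
  have := hw hw0 (by simpa using hwδ)
  rwa [dist_eq_norm, smul_eq_mul, inv_mul_eq_div] at this

lemma hasQDerivAt_internalMap {f : ι → ℂ → ℂ} {f' z : ι → ℂ}
    (h : ∀ᶠ i in U, HasDerivAt (f i) (f' i) (z i)) :
    HasQDerivAt (internalMap U f) (f' : Hyper U ℂ) (z : Hyper U ℂ) := by
  intro ε hε
  induction ε using Germ.inductionOn with | _ ε => ?_
  have hex : ∀ i, ∃ δ : ℝ, 0 < δ ∧ (HasDerivAt (f i) (f' i) (z i) → 0 < ε i → ∀ w : ℂ, w ≠ 0 →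
      ‖w‖ < δ → ‖(f i (z i + w) - f i (z i)) / w - f' i‖ < ε i) := by
    intro i
    by_cases hi : HasDerivAt (f i) (f' i) (z i) ∧ 0 < ε i
    · obtain ⟨δ, hδ, hw⟩ := exists_delta_of_hasDerivAt hi.1 hi.2
      exact ⟨δ, hδ, fun _ _ => hw⟩
    · exact ⟨1, one_pos, fun h1 h2 => absurd ⟨h1, h2⟩ hi⟩
  choose δ hδ hw using hex
  refine ⟨(δ : Hyper U ℝ), Germ.coe_pos.2 (Eventually.of_forall hδ), fun w hw0 hwδ => ?_⟩
  induction w using Germ.inductionOn with | _ w => ?_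
  refine Germ.coe_lt.2 ?_
  filter_upwards [h, Germ.coe_pos.1 hε, hyper_coe_ne hw0, Germ.coe_lt.1 hwδ] with i h1 h2 h3 h4
  exact hw i h1 h2 (w i) h3 h4

lemma hasDerivAt_iterate_deriv {f : ℂ → ℂ} {V : Set ℂ} (hV : IsOpen V)
    (hf : DifferentiableOn ℂ f V) (n : ℕ) {z : ℂ} (hz : z ∈ V) :
    HasDerivAt (deriv^[n] f) (deriv^[n + 1] f z) z := by
  rw [Function.iterate_succ_apply']
  exact ((hf.analyticAt (hV.mem_nhds hz)).iterated_deriv n).differentiableAt.hasDerivAt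

/-- The order of differentiation may vary with the index, so the n-th Q-derivative is the germ of
the n_i-th derivatives, also for infinite n. -/
lemma qAnalyticOn_internalMap {f : ι → ℂ → ℂ} {V : ι → Set ℂ} (hV : ∀ i, IsOpen (V i))
    (hf : ∀ i, DifferentiableOn ℂ (f i) (V i)) {B : Set (Hyper U ℂ)}
    (hB : ∀ z : ι → ℂ, (z : Hyper U ℂ) ∈ B → ∀ᶠ i in U, z i ∈ V i) :
    QAnalyticOn (internalMap U f) B := by
  refine ⟨⟨f, rfl⟩, internalMap₂ U fun i n => deriv^[n] (f i), ⟨_, rfl⟩, ?_, fun n z hz => ?_⟩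
  · funext z
    induction z using Germ.inductionOn with | _ z => rfl
  · induction n using Germ.inductionOn with | _ n => ?_
    induction z using Germ.inductionOn with | _ z => ?_
    have h : internalMap₂ U (fun i n => deriv^[n] (f i)) (n : Hyper U ℕ) =
        internalMap U fun i => deriv^[n i] (f i) := by
      funext w
      induction w using Germ.inductionOn with | _ w => rfl
    rw [h]
    refine hasQDerivAt_internalMap (f := fun i => deriv^[n i] (f i))
      (f' := fun i => deriv^[n i + 1] (f i) (z i)) ?_
    filter_upwards [hB z hz] with i hi
    exact hasDerivAt_iterate_deriv (hV i) (hf i) (n i) hi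

lemma qTendsto_of_tendsto {x : ι → ℕ → ℂ} {L : ι → ℂ}
    (h : ∀ᶠ i in U, Tendsto (x i) atTop (nhds (L i))) :
    QTendsto (internalMap U x) (L : Hyper U ℂ) := by
  intro ε hε
  induction ε using Germ.inductionOn with | _ ε => ?_
  have hex : ∀ i, ∃ N : ℕ, Tendsto (x i) atTop (nhds (L i)) → 0 < ε i → ∀ n, N ≤ n →
      ‖x i n - L i‖ < ε i := by
    intro i
    by_cases hi : Tendsto (x i) atTop (nhds (L i)) ∧ 0 < ε i
    · obtain ⟨N, hN⟩ := Metric.tendsto_atTop.1 hi.1 _ hi.2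
      exact ⟨N, fun _ _ n hn => by simpa [dist_eq_norm] using hN n hn⟩
    · exact ⟨0, fun h1 h2 => absurd ⟨h1, h2⟩ hi⟩
  choose N hN using hex
  refine ⟨(N : Hyper U ℕ), fun n hn => ?_⟩
  induction n using Germ.inductionOn with | _ n => ?_
  refine Germ.coe_lt.2 ?_
  filter_upwards [h, Germ.coe_pos.1 hε, Germ.coe_le.1 hn] with i h1 h2 h3
  exact hN i h1 h2 (n i) h3

lemma mem_ball_of_hyperAbs_lt {a : ℂ} {z : ι → ℂ}
    (hz : hyperAbs ((z : Hyper U ℂ) - ((fun _ => a : ι → ℂ) : Hyper U ℂ)) < 1) :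
    ∀ᶠ i in U, z i ∈ Metric.ball a 1 := by
  have h : ((fun i => ‖z i - a‖ : ι → ℝ) : Hyper U ℝ) < ((fun _ => 1 : ι → ℝ) : Hyper U ℝ) := hz
  filter_upwards [Germ.coe_lt.1 h] with i hi
  rwa [Metric.mem_ball, dist_eq_norm]

lemma hasSimpleQPole_internalMap {f g : ι → ℂ → ℂ} {a : ℂ} {ρ : ι → ℂ} (hρ : ∀ i, ρ i ≠ 0)
    (hg : ∀ i, DifferentiableOn ℂ (g i) (Metric.ball a 1)) (hga : ∀ i, g i a = ρ i)
    (hfg : ∀ i z, z ≠ a → f i z = g i z / (z - a)) :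
    HasSimpleQPole (internalMap U f) ((fun _ => a : ι → ℂ) : Hyper U ℂ) (ρ : Hyper U ℂ) := by
  refine ⟨fun h => ?_, 1, one_pos, internalMap U g,
    qAnalyticOn_internalMap (fun _ => Metric.isOpen_ball) hg fun z hz => mem_ball_of_hyperAbs_lt hz,
    ?_, fun z hz _ => ?_⟩
  · obtain ⟨i, hi⟩ := (Germ.coe_eq.1 h).exists
    exact hρ i hi
  · exact Germ.coe_eq.2 (Eventually.of_forall hga)
  · induction z using Germ.inductionOn with | _ z => ?_
    refine Germ.coe_eq.2 ?_
    filter_upwards [hyper_coe_ne hz] with i hi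
    exact hfg i _ hi

variable (K : HyperNumberField U)

/-- The completed partial zeta function of an internal ideal class. -/
def hyperCompletedZeta (I : K.Cl) : Hyper U ℂ → Hyper U ℂ :=
  internalMap U fun i => completedZeta (F := K.rep i) (Quotient.out I i)

lemma isCompletedZetaContinuation_hyperCompletedZeta (I : K.Cl) :
    K.IsCompletedZetaContinuation I (hyperCompletedZeta K I) := by
  refine ⟨qAnalyticOn_internalMap (V := fun _ => {0, 1}ᶜ)
    (fun _ => (Set.toFinite {(0 : ℂ), 1}).isClosed.isOpen_compl)
    (fun i => differentiableOn_completedZeta _) fun z hz => ?_, fun s hs => ?_⟩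
  · have h0 : (z : Hyper U ℂ) ≠ ((fun _ => 0 : ι → ℂ) : Hyper U ℂ) := fun h => hz (Or.inl h)
    have h1 : (z : Hyper U ℂ) ≠ ((fun _ => 1 : ι → ℂ) : Hyper U ℂ) := fun h => hz (Or.inr h)
    filter_upwards [hyper_coe_ne h0, hyper_coe_ne h1] with i hi0 hi1
    rintro (h | h)
    exacts [hi0 h, hi1 h]
  · induction s using Germ.inductionOn with | _ s => ?_
    have hs' : ∀ᶠ i in U, 1 < (s i).re := Germ.coe_lt.1 hs
    set c := Quotient.out I with hc
    have hex : ∀ i, ∃ σ : ℂ, 1 < (s i).re →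
        Tendsto (fun M => zetaPartialSum (K.rep i) (c i) M (s i)) atTop (nhds σ) ∧
          completedZeta (c i) (s i) = eulerFactorInfty (K.rep i) (s i) * σ := by
      intro i
      by_cases hi : 1 < (s i).re
      · obtain ⟨σ, h⟩ := exists_tendsto_zetaPartialSum (c i) hi
        exact ⟨σ, fun _ => h⟩
      · exact ⟨0, fun h => absurd h hi⟩
    choose σ hσ using hex
    refine ⟨(σ : Hyper U ℂ), ?_, ?_⟩
    · have h : (fun M => K.zetaPartialSum I M (s : Hyper U ℂ)) =
          internalMap U fun i M => zetaPartialSum (K.rep i) (c i) M (s i) := by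
        -- With the class written as that of its chosen family, the lifted partial sum reduces by
        -- computation.
        rw [← Quotient.out_eq I]
        funext M
        induction M using Germ.inductionOn with | _ M => rfl
      rw [HyperNumberField.HasPartialZeta, h]
      refine qTendsto_of_tendsto ?_
      filter_upwards [hs'] with i hi
      exact (hσ i hi).1
    · refine Germ.coe_eq.2 ?_
      filter_upwards [hs'] with i hi
      exact (hσ i hi).2

lemma hyperCompletedZeta_one_sub {I I' : K.Cl} (h : I * I' = K.differentClass) (s : Hyper U ℂ) :
    hyperCompletedZeta K I s = hyperCompletedZeta K I' (1 - s) := by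
  rw [← Quotient.out_eq I, ← Quotient.out_eq I'] at h
  have h' : ∀ᶠ i in U, Quotient.out I i * Quotient.out I' i = differentClass (K.rep i) :=
    Quotient.exact h
  induction s using Germ.inductionOn with | _ s => ?_
  refine Germ.coe_eq.2 ?_
  filter_upwards [h'] with i hi
  -- The standard functional equation evaluates its first class at 1 - s, so `I'` must come first.
  rw [mul_comm] at hi
  exact (completedZeta_one_sub hi (s i)).symm

lemma hasSimpleQPole_hyperCompletedZeta_zero (I : K.Cl) :
    HasSimpleQPole (hyperCompletedZeta K I) 0 (-K.residueConst) :=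
  hasSimpleQPole_internalMap (ρ := fun i => -residueConst (K.rep i))
    (fun _ => neg_ne_zero.2 residueConst_ne_zero)
    (fun _ => differentiableOn_zetaNumerator₀ _) (fun _ => zetaNumerator₀_zero _)
    fun i z hz => by rw [sub_zero, completedZeta_eq_div _ hz]

lemma hasSimpleQPole_hyperCompletedZeta_one (I : K.Cl) :
    HasSimpleQPole (hyperCompletedZeta K I) 1 K.residueConst :=
  hasSimpleQPole_internalMap (ρ := fun i => residueConst (K.rep i))
    (fun _ => residueConst_ne_zero)
    (fun _ => differentiableOn_zetaNumerator₁ _) (fun _ => zetaNumerator₁_one _)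
    fun _ _ hz => completedZeta_eq_div_sub_one _ hz

end Transfer

end HyperZeta

end

theorem mainTheorem4 {ι : Type*} (U : Ultrafilter ι) (K : HyperZeta.HyperNumberField U) :
    ∃ Z : K.Cl → HyperZeta.Hyper U ℂ → HyperZeta.Hyper U ℂ,
      (∀ I : K.Cl, K.IsCompletedZetaContinuation I (Z I)) ∧
      (∀ I I' : K.Cl, I * I' = K.differentClass →
        ∀ s : HyperZeta.Hyper U ℂ, s ≠ 0 → s ≠ 1 → Z I s = Z I' (1 - s)) ∧
      (∀ I : K.Cl, HyperZeta.HasSimpleQPole (Z I) 0 (-K.residueConst)) ∧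
      (∀ I : K.Cl, HyperZeta.HasSimpleQPole (Z I) 1 K.residueConst) :=
  ⟨HyperZeta.hyperCompletedZeta K,
    HyperZeta.isCompletedZetaContinuation_hyperCompletedZeta K,
    fun _ _ h s _ _ => HyperZeta.hyperCompletedZeta_one_sub K h s,
    HyperZeta.hasSimpleQPole_hyperCompletedZeta_zero K,
    HyperZeta.hasSimpleQPole_hyperCompletedZeta_one K⟩
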